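/- Let $p>2$ be a prime, let $K=\overline{\mathbb F}_p$, let $n\ge 1$, and let $P_1(u),\dots,P_{n-1}(u)\in K[u]$ be monic polynomials. The Yangian $Y(\mathfrak{gl}_n)$ is the associative unital $K$-algebra with generators $t_{ij}^{(r)}$ ($1\le i,j\le n$, $r\ge 1$) and relations $(u-v)[t_{ij}(u),t_{kl}(v)]=t_{kj}(u)t_{il}(v)-t_{kj}(v)t_{il}(u)$, where $t_{ij}(u)=\delta_{ij}+\sum_{r\ge1}t_{ij}^{(r)}u^{-r}$. It has the coproduct $t_{ij}(u)\mapsto\sum_k t_{ik}(u)\otimes t_{kj}(u)$, by which tensor products of modules are formed. An evaluation module is a finite-dimensional irreducible $\mathfrak{gl}_n$-module over $K$ on which $Y(\mathfrak{gl}_n)$ acts through the homomorphism $Y(\mathfrak{gl}_n)\to U(\mathfrak{gl}_n)$, $t_{ij}(u)\mapsto\delta_{ij}+E_{ij}u^{-1}$. For $\mu(u)=(\mu_1(u),\dots,\mu_n(u))$ with $\mu_i(u)=1+\sum_{r\ge1}\mu_i^{(r)}u^{-r}\in 1+u^{-1}K[[u^{-1}]]$, the Verma module $M(\mu(u),p)$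 is the quotient of $Y(\mathfrak{gl}_n)$ by the left ideal generated by all $t_{ij}^{(r)}$ with $i<j$ and all $t_{ii}^{(r)}-\mu_i^{(r)}$ ($r\ge1$). It is graded by the root lattice, $t_{ij}^{(r)}$ having degree $\varepsilon_i-\varepsilon_j$, and $L(\mu(u),p)$ denotes its quotient by the sum of all its proper graded submodules. Then there is $\mu(u)$ as above such that $$\frac{\mu_i(u)}{\mu_{i+1}(u)}=\frac{P_i(u+1)}{P_i(u)}\qquad(1\le i\le n-1)$$ in $K((u^{-1}))$, and such that the $Y(\mathfrak{gl}_n)$-module $L(\mu(u),p)$ is finite-dimensional over $K$, irreducible, and isomorphic to a subquotient of a tensor product of finitely many evaluation modules. -/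

import Mathlib

universe u

attribute [local instance 100] LieRing.ofAssociativeRing

/-- A system of elements `a i j r` (standing for `t_ij^(r)`, with `t_ij^(0) = δ_ij`) of an
algebra satisfying the defining relations of the Yangian of `gl_n`. For the generating series
`t_ij(u) = ∑ r, t_ij^(r) u^(-r)` the second condition is the coefficient form of
`(u - v) [t_ij(u), t_kl(v)] = t_kj(u) t_il(v) - t_kj(v) t_il(u)`,
that is, of the ternary relation `R(u - v) T₁(u) T₂(v) = T₂(v) T₁(u) R(u - v)`
with `R(u) = 1 - σ u⁻¹`, where `σ` is the flip of `K^n ⊗ K^n`. -/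
structure IsRTT {A : Type*} [Ring A] {n : ℕ} (a : Fin n → Fin n → ℕ → A) : Prop where
  zero : ∀ i j, a i j 0 = if i = j then 1 else 0
  rel : ∀ i j k l r s,
    (a i j (r + 1) * a k l s - a k l s * a i j (r + 1))
      - (a i j r * a k l (s + 1) - a k l (s + 1) * a i j r)
    = a k j r * a i l s - a k j s * a i l r

namespace Yangian

/-- The symbols `t_ij^(r)` in the free algebra on the generators `t_ij^(r)`, `r ≥ 1`
(the generator with index `(i, j, r)` is `t_ij^(r+1)`), with `t_ij^(0) = δ_ij`. -/
noncomputable def tFree (K : Type*) [CommRing K] (n : ℕ) (i j : Fin n) :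
    ℕ → FreeAlgebra K (Fin n × Fin n × ℕ)
  | 0 => if i = j then 1 else 0
  | r + 1 => FreeAlgebra.ι K (i, j, r)

/-- The defining relations of the Yangian. -/
inductive Rel (K : Type*) [CommRing K] (n : ℕ) :
    FreeAlgebra K (Fin n × Fin n × ℕ) → FreeAlgebra K (Fin n × Fin n × ℕ) → Prop
  | rtt (i j k l : Fin n) (r s : ℕ) : Rel K n
      ((tFree K n i j (r + 1) * tFree K n k l s - tFree K n k l s * tFree K n i j (r + 1))
        - (tFree K n i j r * tFree K n k l (s + 1) - tFree K n k l (s + 1) * tFree K n i j r))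
      (tFree K n k j r * tFree K n i l s - tFree K n k j s * tFree K n i l r)

end Yangian

/-- The Yangian `Y(gl_n)` over `K`. -/
abbrev Yangian (K : Type*) [CommRing K] (n : ℕ) : Type _ := RingQuot (Yangian.Rel K n)

namespace Yangian

section Basic

variable (K : Type*) [CommRing K] (n : ℕ)

/-- The elements `t_ij^(r)` of the Yangian. -/
noncomputable def t (i j : Fin n) (r : ℕ) : Yangian K n :=
  RingQuot.mkAlgHom K (Rel K n) (tFree K n i j r)

theorem isRTT_t : IsRTT (t K n) where
  zero i j := by
    unfold t tFree
    split_ifs <;> simp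
  rel i j k l r s := by
    have h := RingQuot.mkAlgHom_rel K (Rel.rtt (K := K) (n := n) i j k l r s)
    simpa only [map_sub, map_mul, t] using h

variable {K n}

/-- The universal property of the Yangian. -/
noncomputable def lift {A : Type*} [Ring A] [Algebra K A] (a : Fin n → Fin n → ℕ → A)
    (ha : IsRTT a) : Yangian K n →ₐ[K] A :=
  RingQuot.liftAlgHom K
    ⟨FreeAlgebra.lift K (fun x : Fin n × Fin n × ℕ => a x.1 x.2.1 (x.2.2 + 1)), by
      have key : ∀ i j r, FreeAlgebra.lift K
          (fun x : Fin n × Fin n × ℕ => a x.1 x.2.1 (x.2.2 + 1)) (tFree K n i j r) = a i j r := by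
        intro i j r
        cases r with
        | zero => rw [ha.zero]; unfold tFree; split_ifs <;> simp
        | succ r => simp [tFree]
      rintro _ _ ⟨i, j, k, l, r, s⟩
      simp only [map_sub, map_mul, key]
      exact ha.rel i j k l r s⟩

theorem lift_t {A : Type*} [Ring A] [Algebra K A] (a : Fin n → Fin n → ℕ → A)
    (ha : IsRTT a) (i j : Fin n) (r : ℕ) : lift (K := K) a ha (t K n i j r) = a i j r := by
  unfold lift t
  rw [RingQuot.liftAlgHom_mkAlgHom_apply]
  cases r with
  | zero => rw [ha.zero]; unfold tFree; split_ifs <;> simp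
  | succ r => simp [tFree]

end Basic

section Coproduct

variable {A : Type*} [Ring A]

open PowerSeries in
/-- The defining relations in terms of generating series: the inner variable of `A⟦X⟧⟦X⟧` is
`u⁻¹` and the outer one is `v⁻¹`. -/
theorem rel_iff_series (f g h e : PowerSeries A)
    (hf : ∀ s, coeff 0 f * coeff s g = coeff s g * coeff 0 f)
    (hg : ∀ r, coeff r f * coeff 0 g = coeff 0 g * coeff r f) :
    ((X - C X : PowerSeries (PowerSeries A)) * (C f * map C g - map C g * C f)
      = X * (C X * (C h * map C e - map C h * C e))) ↔
    ∀ r s, (coeff (r + 1) f * coeff s g - coeff s g * coeff (r + 1) f)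
      - (coeff r f * coeff (s + 1) g - coeff (s + 1) g * coeff r f)
      = coeff r h * coeff s e - coeff s h * coeff r e := by
  constructor
  · intro H r s
    have := congrArg (fun φ => coeff (r + 1) (coeff (s + 1) φ)) H
    rw [sub_sub_sub_comm]
    simpa [sub_mul, mul_sub, mul_assoc, coeff_succ_X_mul] using this
  · intro H
    ext s r
    rcases s with _ | s <;> rcases r with _ | r
    · simp [sub_mul]
    · have := hg r
      simp only [coeff_zero_eq_constantCoeff] at this
      have hc : constantCoeff (map (C (R := A)) g) = C (constantCoeff g) := by
        rw [← coeff_zero_eq_constantCoeff_apply, coeff_map, coeff_zero_eq_constantCoeff_apply]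
      simp [sub_mul, mul_sub, coeff_succ_X_mul, hc, this]
    · have := hf s
      simp only [coeff_zero_eq_constantCoeff] at this
      simp [sub_mul, mul_sub, this]
    · have := H r s
      rw [sub_sub_sub_comm] at this
      simpa [sub_mul, mul_sub, mul_assoc, coeff_succ_X_mul] using this

open PowerSeries in
theorem isRTT_iff_series {n : ℕ} (a : Fin n → Fin n → ℕ → A) :
    IsRTT a ↔ (∀ i j, a i j 0 = if i = j then 1 else 0) ∧ ∀ i j k l,
      (X - C X : PowerSeries (PowerSeries A)) *
        (C (mk (a i j)) * map C (mk (a k l)) - map C (mk (a k l)) * C (mk (a i j)))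
      = X * (C X * (C (mk (a k j)) * map C (mk (a i l))
          - map C (mk (a k j)) * C (mk (a i l)))) := by
  constructor
  · rintro ⟨h0, h⟩
    refine ⟨h0, fun i j k l => (rel_iff_series _ _ _ _ ?_ ?_).2 ?_⟩
    · intro s
      simp only [coeff_mk, h0]
      split_ifs <;> simp
    · intro s
      simp only [coeff_mk, h0]
      split_ifs <;> simp
    · intro r s
      simpa only [coeff_mk] using h i j k l r s
  · rintro ⟨h0, h⟩
    refine ⟨h0, fun i j k l r s => ?_⟩
    have := (rel_iff_series _ _ _ _ ?_ ?_).1 (h i j k l) r s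
    · simpa only [coeff_mk] using this
    · intro s
      simp only [coeff_mk, h0]
      split_ifs <;> simp
    · intro s
      simp only [coeff_mk, h0]
      split_ifs <;> simp

/-- The algebraic identity behind the coproduct: `x, y` are central, `a, b` (and `a', b'`)
are the matrices `T(u)` (and `T(v)`) of two systems with commuting entries. -/
theorem comul_aux {R : Type*} [Ring R] {n : ℕ} (z w : R) (hz : ∀ c, Commute z c)
    (a a' b b' : Fin n → Fin n → R)
    (h1 : ∀ i j k l, Commute (a i j) (b' k l)) (h2 : ∀ i j k l, Commute (a' i j) (b k l))
    (ha : ∀ i j k l, z * (a i j * a' k l - a' k l * a i j)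
      = w * (a k j * a' i l - a' k j * a i l))
    (hb : ∀ i j k l, z * (b i j * b' k l - b' k l * b i j)
      = w * (b k j * b' i l - b' k j * b i l)) (hw : ∀ c, Commute w c) (i j k l : Fin n) :
    z * ((∑ m, a i m * b m j) * (∑ q, a' k q * b' q l)
        - (∑ q, a' k q * b' q l) * (∑ m, a i m * b m j))
      = w * ((∑ m, a k m * b m j) * (∑ q, a' i q * b' q l)
        - (∑ m, a' k m * b' m j) * (∑ q, a i q * b q l)) := by
  have e1 : ∀ m q, z * (a i m * b m j * (a' k q * b' q l) - a' k q * b' q l * (a i m * b m j))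
      = w * ((a k m * a' i q - a' k m * a i q) * (b m j * b' q l)
        + a' k q * a i m * (b q j * b' m l - b' q j * b m l)) := by
    intro m q
    have s1 : a i m * b m j * (a' k q * b' q l) = a i m * a' k q * (b m j * b' q l) := by
      rw [mul_assoc, ← mul_assoc (b m j), ← (h2 k q m j).eq]; simp only [mul_assoc]
    have s2 : a' k q * b' q l * (a i m * b m j) = a' k q * a i m * (b' q l * b m j) := by
      rw [mul_assoc, ← mul_assoc (b' q l), ← (h1 i m q l).eq]; simp only [mul_assoc]
    have s3 : a i m * a' k q * (b m j * b' q l) - a' k q * a i m * (b' q l * b m j)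
        = (a i m * a' k q - a' k q * a i m) * (b m j * b' q l)
          + a' k q * a i m * (b m j * b' q l - b' q l * b m j) := by noncomm_ring
    rw [s1, s2, s3, mul_add, ← mul_assoc z, ha, ← mul_assoc z, (hz (a' k q * a i m)).eq,
      mul_assoc _ z, hb, ← mul_assoc _ w, ← (hw (a' k q * a i m)).eq, mul_add]
    simp only [mul_assoc]
  have L : (∑ m, a i m * b m j) * (∑ q, a' k q * b' q l)
        - (∑ q, a' k q * b' q l) * (∑ m, a i m * b m j)
      = ∑ m, ∑ q, (a i m * b m j * (a' k q * b' q l) - a' k q * b' q l * (a i m * b m j)) := by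
    rw [Finset.sum_mul_sum, Finset.sum_mul_sum]
    conv_lhs => rw [Finset.sum_comm (f := fun q m => a' k q * b' q l * (a i m * b m j))]
    simp only [Finset.sum_sub_distrib]
  rw [L]
  simp only [Finset.mul_sum, e1]
  simp only [← Finset.mul_sum]
  congr 1
  have s4 : ∀ m q, a k m * b m j * (a' i q * b' q l) = a k m * a' i q * (b m j * b' q l) := by
    intro m q
    rw [mul_assoc, ← mul_assoc (b m j), ← (h2 i q m j).eq]; simp only [mul_assoc]
  have s5 : ∀ m q, a' k m * b' m j * (a i q * b q l) = a' k m * a i q * (b' m j * b q l) := by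
    intro m q
    rw [mul_assoc, ← mul_assoc (b' m j), ← (h1 i q m j).eq]; simp only [mul_assoc]
  rw [Finset.sum_mul_sum, Finset.sum_mul_sum]
  simp only [s4, s5, sub_mul, mul_sub, Finset.sum_add_distrib, Finset.sum_sub_distrib]
  rw [Finset.sum_comm (f := fun m q => a' k q * a i m * (b q j * b' m l)),
    Finset.sum_comm (f := fun m q => a' k q * a i m * (b' q j * b m l))]
  abel

open PowerSeries in
/-- If two systems with commuting entries satisfy the relations of the Yangian, so does
`∑ m, t_im(u) t_mj(u)`, the product of the first and the second matrix. -/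
theorem isRTT_mul {n : ℕ} {a b : Fin n → Fin n → ℕ → A} (ha : IsRTT a) (hb : IsRTT b)
    (hab : ∀ i j r k l s, Commute (a i j r) (b k l s)) :
    IsRTT (fun i j r => ∑ m, ∑ x ∈ Finset.HasAntidiagonal.antidiagonal r, a i m x.1 * b m j x.2) := by
  rw [isRTT_iff_series]
  constructor
  · intro i j
    simp [ha.zero, hb.zero]
  · have hmk : ∀ i j, mk (fun r => ∑ m, ∑ x ∈ Finset.HasAntidiagonal.antidiagonal r, a i m x.1 * b m j x.2)
        = ∑ m, mk (a i m) * mk (b m j) := by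
      intro i j
      ext r
      simp [coeff_mul]
    rw [isRTT_iff_series] at ha hb
    have hX : ∀ c : PowerSeries (PowerSeries A), Commute (X : PowerSeries (PowerSeries A)) c :=
      fun c => (commute_X c).symm
    have hCX : ∀ c : PowerSeries (PowerSeries A),
        Commute (C X : PowerSeries (PowerSeries A)) c := by
      intro c
      ext s : 1
      simp only [coeff_C_mul, coeff_mul_C]
      exact ((commute_X _).symm).eq
    intro i j k l
    simp only [hmk, map_sum, map_mul]
    rw [← mul_assoc X]
    refine comul_aux (X - C X) (X * C X) ?_ (fun i j => C (mk (a i j)))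
      (fun i j => map C (mk (a i j))) (fun i j => C (mk (b i j)))
      (fun i j => map C (mk (b i j))) ?_ ?_ ?_ ?_ ?_ i j k l
    · exact fun c => (hX c).sub_left (hCX c)
    · intro i j k l
      ext s r
      simpa [coeff_C_mul, coeff_mul_C] using (hab i j r k l s).eq
    · intro i j k l
      ext s r
      simpa [coeff_C_mul, coeff_mul_C] using (hab i j s k l r).eq
    · intro i j k l
      rw [mul_assoc]; exact ha.2 i j k l
    · intro i j k l
      rw [mul_assoc]; exact hb.2 i j k l
    · exact fun c => (hX c).mul_left (hCX c)

theorem isRTT_map {B : Type*} [Ring B] {n : ℕ} {a : Fin n → Fin n → ℕ → A} (ha : IsRTT a)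
    (φ : A →+* B) : IsRTT (fun i j r => φ (a i j r)) where
  zero i j := by rw [ha.zero]; split_ifs <;> simp
  rel i j k l r s := by simpa only [map_sub, map_mul] using congrArg φ (ha.rel i j k l r s)

open TensorProduct in
theorem isRTT_comul (K : Type*) [CommRing K] (n : ℕ) :
    IsRTT (fun i j r => ∑ m, ∑ x ∈ Finset.HasAntidiagonal.antidiagonal r,
      (t K n i m x.1 ⊗ₜ[K] t K n m j x.2 : Yangian K n ⊗[K] Yangian K n)) := by
  have h := isRTT_mul
    (isRTT_map (B := Yangian K n ⊗[K] Yangian K n) (isRTT_t K n)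
      (Algebra.TensorProduct.includeLeft (R := K) (S := K)
      (A := Yangian K n) (B := Yangian K n) : _ →ₐ[K] _).toRingHom)
    (isRTT_map (B := Yangian K n ⊗[K] Yangian K n) (isRTT_t K n)
      (Algebra.TensorProduct.includeRight (R := K)
      (A := Yangian K n) (B := Yangian K n)).toRingHom)
    (by intro i j r k l s; simp [Commute, SemiconjBy])
  simpa using h

open TensorProduct in
/-- The coproduct `t_ij(u) ↦ ∑ m, t_im(u) ⊗ t_mj(u)`. -/
noncomputable def comul (K : Type*) [CommRing K] (n : ℕ) :
    Yangian K n →ₐ[K] Yangian K n ⊗[K] Yangian K n :=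
  lift _ (isRTT_comul K n)

theorem isRTT_counit (K : Type*) [CommRing K] (n : ℕ) :
    IsRTT (fun (i j : Fin n) (r : ℕ) => if r = 0 ∧ i = j then (1 : K) else 0) where
  zero i j := by simp
  rel i j k l r s := by
    rcases r with _ | r <;> rcases s with _ | s <;> simp

/-- The counit `t_ij(u) ↦ δ_ij`. -/
noncomputable def counit (K : Type*) [CommRing K] (n : ℕ) : Yangian K n →ₐ[K] K :=
  lift _ (isRTT_counit K n)

end Coproduct

section Evaluation

/-- The elements `δ_ij + E_ij u⁻¹` of `U(gl_n)[u⁻¹]`, by coefficients. -/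
noncomputable def evFun (K : Type*) [CommRing K] (n : ℕ) (i j : Fin n) :
    ℕ → UniversalEnvelopingAlgebra K (Matrix (Fin n) (Fin n) K)
  | 0 => if i = j then 1 else 0
  | 1 => UniversalEnvelopingAlgebra.ι K (Matrix.single i j (1 : K))
  | _ + 2 => 0

theorem isRTT_evFun (K : Type*) [CommRing K] (n : ℕ) : IsRTT (evFun K n) where
  zero _ _ := rfl
  rel i j k l r s := by
    have hE : ∀ i j k l : Fin n,
        evFun K n i j 1 * evFun K n k l 1 - evFun K n k l 1 * evFun K n i j 1
        = evFun K n k j 0 * evFun K n i l 1 - evFun K n k j 1 * evFun K n i l 0 := by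
      intro i j k l
      have h := (UniversalEnvelopingAlgebra.ι K).map_lie
        (Matrix.single i j (1 : K)) (Matrix.single k l (1 : K))
      rw [LieRing.of_associative_ring_bracket, LieRing.of_associative_ring_bracket] at h
      simp only [evFun]
      rw [← h, map_sub]
      by_cases h1 : j = k <;> by_cases h2 : l = i
      · subst h1 h2; simp
      · subst h1; simp [h2, Ne.symm h2]
      · subst h2; simp [h1, Ne.symm h1]
      · simp [h1, h2, Ne.symm h1, Ne.symm h2]
    have h0 : ∀ i j (x : UniversalEnvelopingAlgebra K (Matrix (Fin n) (Fin n) K)),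
        evFun K n i j 0 * x = x * evFun K n i j 0 := by
      intro i j x
      simp only [evFun]
      split_ifs <;> simp
    have h2 : ∀ i j r, evFun K n i j (r + 2) = 0 := fun _ _ _ => rfl
    rcases r with _ | _ | r <;> rcases s with _ | _ | s <;>
      simp only [zero_add, add_assoc, Nat.reduceAdd, h2, mul_zero, zero_mul, sub_self, sub_zero]
    · rw [h0 k l, h0 i j]; simp
    · exact hE i j k l
    · rw [hE i j k l]; abel

/-- The evaluation homomorphism `ev : Y(gl_n) → U(gl_n)`, `t_ij(u) ↦ δ_ij + E_ij u⁻¹`. -/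
noncomputable def ev (K : Type*) [CommRing K] (n : ℕ) :
    Yangian K n →ₐ[K] UniversalEnvelopingAlgebra K (Matrix (Fin n) (Fin n) K) :=
  lift _ (isRTT_evFun K n)

end Evaluation

end Yangian

/-- A representation of the Yangian `Y(gl_n)` over the field `K`. -/
structure YangianRep (K : Type u) [Field K] (n : ℕ) where
  /-- The underlying vector space. -/
  V : Type u
  [addCommGroup : AddCommGroup V]
  [module : Module K V]
  /-- The action of the Yangian. -/
  ρ : Yangian K n →ₐ[K] Module.End K V

namespace YangianRep

attribute [instance] YangianRep.addCommGroup YangianRep.module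

variable {K : Type u} [Field K] {n : ℕ}

noncomputable instance (W : YangianRep K n) : Module (Yangian K n) W.V :=
  Module.compHom W.V W.ρ.toRingHom

/-- The trivial representation, given by the counit. -/
noncomputable def trivial (K : Type u) [Field K] (n : ℕ) : YangianRep K n where
  V := K
  ρ := (Algebra.ofId K (Module.End K K)).comp (Yangian.counit K n)

open TensorProduct in
/-- The tensor product of two representations, given by the coproduct. -/
noncomputable def tensor (W₁ W₂ : YangianRep K n) : YangianRep K n where
  V := W₁.V ⊗[K] W₂.V
  ρ := (Module.endTensorEndAlgHom (R := K) (S := K) (A := K)).comp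
    ((Algebra.TensorProduct.map W₁.ρ W₂.ρ).comp (Yangian.comul K n))

/-- The tensor product `W₁ ⊗ (W₂ ⊗ (⋯ ⊗ (W_k ⊗ K)))` of a finite list of representations,
where `K` is the trivial representation. -/
noncomputable def tensorList (l : List (YangianRep K n)) : YangianRep K n :=
  l.foldr tensor (trivial K n)

/-- `W` is an evaluation module: a finite-dimensional irreducible representation of `gl_n`,
on which the Yangian acts through `ev : Y(gl_n) → U(gl_n)`. -/
def IsEvaluationModule (W : YangianRep K n) : Prop :=
  ∃ (_ : LieRingModule (Matrix (Fin n) (Fin n) K) W.V)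
    (_ : LieModule K (Matrix (Fin n) (Fin n) K) W.V),
    Module.Finite K W.V ∧
    LieModule.IsIrreducible K (Matrix (Fin n) (Fin n) K) W.V ∧
    W.ρ = (UniversalEnvelopingAlgebra.lift K
      (LieModule.toEnd K (Matrix (Fin n) (Fin n) K) W.V)).comp (Yangian.ev K n)

end YangianRep

namespace Yangian

section HighestWeight

variable {K : Type u} [Field K] {n : ℕ}

/-- The left ideal generated by all `t_ij^(r)` with `i < j`, `r ≥ 1`, and all
`t_ii^(r) - μ_i^(r)` with `r ≥ 1`, where `μ_i(u) = ∑ r, μ_i^(r) u^(-r)`; the variable of the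
power series is `u⁻¹`. -/
noncomputable def vermaIdeal (μ : Fin n → PowerSeries K) :
    Submodule (Yangian K n) (Yangian K n) :=
  Submodule.span (Yangian K n)
    ({x | ∃ (i j : Fin n) (r : ℕ), i < j ∧ x = t K n i j (r + 1)} ∪
     {x | ∃ (i : Fin n) (r : ℕ), x = t K n i i (r + 1)
        - algebraMap K (Yangian K n) (PowerSeries.coeff (r + 1) (μ i))})

/-- The Verma module `M(μ(u))`. -/
abbrev Verma (μ : Fin n → PowerSeries K) : Type u :=
  Yangian K n ⧸ vermaIdeal μ

/-- The degree `ε_i - ε_j` in the root lattice of the generator `t_ij^(r)`. -/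
def genDegree (x : Fin n × Fin n × ℕ) : Fin n → ℤ :=
  Pi.single x.1 1 - Pi.single x.2.1 1

/-- The homogeneous component of degree `d` of the Verma module in its grading by the root
lattice: the span of the images of the monomials in the `t_ij^(r)`, `r ≥ 1`, of degree `d`. -/
noncomputable def vermaComponent (μ : Fin n → PowerSeries K) (d : Fin n → ℤ) :
    Submodule K (Verma μ) :=
  Submodule.span K
    {v | ∃ l : List (Fin n × Fin n × ℕ), (l.map genDegree).sum = d ∧
      v = (vermaIdeal μ).mkQ (l.map (fun x => t K n x.1 x.2.1 (x.2.2 + 1))).prod}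

/-- A submodule of the Verma module is graded if it is generated by homogeneous elements. -/
def IsGraded {μ : Fin n → PowerSeries K} (N : Submodule (Yangian K n) (Verma μ)) : Prop :=
  Submodule.span (Yangian K n) {v | v ∈ N ∧ ∃ d, v ∈ vermaComponent μ d} = N

/-- The sum of all proper graded submodules of the Verma module. -/
noncomputable def vermaRadical (μ : Fin n → PowerSeries K) :
    Submodule (Yangian K n) (Verma μ) :=
  sSup {N | IsGraded N ∧ N ≠ ⊤}

/-- The module `L(μ(u))`: the irreducible quotient of the Verma module `M(μ(u))`, by the sum of
all its proper graded submodules. (In characteristic zero every submodule is graded. In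
characteristic `p` there may be further simple quotients, which are not graded.) -/
abbrev IrredHW (μ : Fin n → PowerSeries K) : Type u :=
  Verma μ ⧸ vermaRadical μ

/-- The `Y(gl_n)`-module `L` is a subquotient of the representation `W`. -/
def IsSubquotient (L : Type*) [AddCommGroup L] [Module (Yangian K n) L]
    (W : YangianRep K n) : Prop :=
  ∃ (B : Submodule (Yangian K n) W.V) (f : B →ₗ[Yangian K n] L), Function.Surjective f

end HighestWeight

end Yangian

/-- The value `P(u + c)` in the field `K((u⁻¹))` of formal Laurent series in `u⁻¹`. -/
noncomputable def evalShift {K : Type*} [Field K] (P : Polynomial K) (c : K) : LaurentSeries K :=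
  P.eval₂ HahnSeries.C (HahnSeries.single (-1) 1 + HahnSeries.C c)

/-! The module is found inside an explicit tensor product. Let `Λ^k` be the `k`-th exterior power of
the vector representation, twisted by `a` times the trace. It is irreducible in every
characteristic, and its top vector has weight series `1 + (1 + a)u⁻¹` in the first `k` places and `1
+ a u⁻¹` in the others. For `a = -b` the ratio of neighbouring series is `(u + 1 - b)/(u - b)` at
place `k` and `1` elsewhere. Since `K` is algebraically closed, each `P_k` is a product of factors
`u - b`. Tensoring one `Λ^k` for each root `b` of each `P_k` gives a finite-dimensional module `W`
in which the product of the top vectors is a highest weight vector `v`, whose series multiply to the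
prescribed ratios (`coe_prod_weight_div`).

It remains to relate `L(μ)` to `W`. The vector `v` defines a map from the Verma module to `W`. If
its kernel is graded, it lies in the radical, so `L(μ)` is a quotient of the submodule generated by
`v`. In characteristic `p` the Cartan subalgebra sees weights only modulo `p` and cannot prove
gradedness. The algebraic torus `(Kˣ)^n` can: it acts on `W` compatibly with the degrees, and its
characters `z ↦ z^d` are distinct and hence linearly independent, because `K` is infinite
(`mem_of_sum_torusChar_smul_mem`). This separation of degrees in `W` also replaces any proof that
the components of the Verma module are independent.

For irreducibility, the triangular ordering of words shows that components of positive height vanish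
and that degree zero is the line of the canonical generator. So the radical is proper, and modulo it
a homogeneous vector killed by all raising operators is a multiple of the generator. An induction on
depth (`mem_vermaRadical_of_depth`) then shows that every submodule above the radical, graded or
not, either contains the generator or equals the radical. -/

namespace Yangian

/-! ### Words in the generators and their triangular ordering -/

section Ordering

variable {K : Type u} [Field K] {n : ℕ}

/-- The monomial `t_{i₁j₁}^(r₁+1) ⋯` attached to a word in the generators. -/
noncomputable def word (K : Type u) [Field K] {n : ℕ} (l : List (Fin n × Fin n × ℕ)) :
    Yangian K n :=
  (l.map fun x => t K n x.1 x.2.1 (x.2.2 + 1)).prod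

@[simp] theorem word_nil : word K ([] : List (Fin n × Fin n × ℕ)) = 1 := rfl

@[simp] theorem word_cons (x : Fin n × Fin n × ℕ) (l : List (Fin n × Fin n × ℕ)) :
    word K (x :: l) = t K n x.1 x.2.1 (x.2.2 + 1) * word K l := by
  simp [word]

@[simp] theorem word_append (l l' : List (Fin n × Fin n × ℕ)) :
    word K (l ++ l') = word K l * word K l' := by
  simp [word]

/-- The root lattice degree of a word. -/
def wordDegree (l : List (Fin n × Fin n × ℕ)) : Fin n → ℤ := (l.map genDegree).sum

/-- The filtration degree of a word, for which `t_ij^(r)` has degree `r`. -/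
def wordWeight (l : List (Fin n × Fin n × ℕ)) : ℕ := (l.map fun x => x.2.2 + 1).sum

@[simp] theorem wordDegree_nil : wordDegree ([] : List (Fin n × Fin n × ℕ)) = 0 := rfl

@[simp] theorem wordDegree_cons (x : Fin n × Fin n × ℕ) (l : List (Fin n × Fin n × ℕ)) :
    wordDegree (x :: l) = genDegree x + wordDegree l := by
  simp [wordDegree]

@[simp] theorem wordDegree_append (l l' : List (Fin n × Fin n × ℕ)) :
    wordDegree (l ++ l') = wordDegree l + wordDegree l' := by
  simp [wordDegree]

@[simp] theorem wordWeight_nil : wordWeight ([] : List (Fin n × Fin n × ℕ)) = 0 := rfl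

@[simp] theorem wordWeight_cons (x : Fin n × Fin n × ℕ) (l : List (Fin n × Fin n × ℕ)) :
    wordWeight (x :: l) = x.2.2 + 1 + wordWeight l := by
  simp [wordWeight]

@[simp] theorem wordWeight_append (l l' : List (Fin n × Fin n × ℕ)) :
    wordWeight (l ++ l') = wordWeight l + wordWeight l' := by
  simp [wordWeight]

theorem wordDegree_perm {l l' : List (Fin n × Fin n × ℕ)} (h : l.Perm l') :
    wordDegree l = wordDegree l' :=
  (h.map _).sum_eq

theorem wordWeight_perm {l l' : List (Fin n × Fin n × ℕ)} (h : l.Perm l') :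
    wordWeight l = wordWeight l' :=
  (h.map _).sum_eq

/-- The span of the words of degree `d`. -/
noncomputable def component (K : Type u) [Field K] {n : ℕ} (d : Fin n → ℤ) :
    Submodule K (Yangian K n) :=
  Submodule.span K {y | ∃ l, wordDegree l = d ∧ y = word K l}

/-- The span of the words of degree `d` and of filtration degree less than `m`. -/
noncomputable def filtered (K : Type u) [Field K] {n : ℕ} (m : ℕ) (d : Fin n → ℤ) :
    Submodule K (Yangian K n) :=
  Submodule.span K {y | ∃ l, wordWeight l < m ∧ wordDegree l = d ∧ y = word K l}

theorem filtered_mono {m m' : ℕ} (h : m ≤ m') (d : Fin n → ℤ) :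
    filtered K m d ≤ filtered K m' d :=
  Submodule.span_mono fun _ ⟨l, h₁, h₂⟩ => ⟨l, h₁.trans_le h, h₂⟩

theorem word_mem_filtered {l : List (Fin n × Fin n × ℕ)} {m : ℕ} (h : wordWeight l < m) :
    word K l ∈ filtered K m (wordDegree l) :=
  Submodule.subset_span ⟨l, h, rfl, rfl⟩

theorem word_mem_component (l : List (Fin n × Fin n × ℕ)) :
    word K l ∈ component K (wordDegree l) :=
  Submodule.subset_span ⟨l, rfl, rfl⟩

/-- The bounds are strict, so weights below `m` and `m'` add up to at most `m + m' - 2`; this is the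
source of `k + 1`. -/
theorem mul_mem_filtered {m m' k : ℕ} {d d' e : Fin n → ℤ} {x y : Yangian K n}
    (hx : x ∈ filtered K m d) (hy : y ∈ filtered K m' d') (hk : m + m' ≤ k + 1)
    (he : e = d + d') : x * y ∈ filtered K k e := by
  have : x * y ∈ filtered K m d * filtered K m' d' := Submodule.mul_mem_mul hx hy
  rw [filtered, filtered, Submodule.span_mul_span] at this
  refine Submodule.span_mono ?_ this
  rintro _ ⟨_, ⟨l, h₁, h₂, rfl⟩, _, ⟨l', h₃, h₄, rfl⟩, rfl⟩
  refine ⟨l ++ l', ?_, ?_, by simp⟩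
  · rw [wordWeight_append]; omega
  · rw [wordDegree_append, h₂, h₄, he]

theorem mul_mem_component {d d' : Fin n → ℤ} {x y : Yangian K n}
    (hx : x ∈ component K d) (hy : y ∈ component K d') : x * y ∈ component K (d + d') := by
  have : x * y ∈ component K d * component K d' := Submodule.mul_mem_mul hx hy
  rw [component, component, Submodule.span_mul_span] at this
  refine Submodule.span_mono ?_ this
  rintro _ ⟨_, ⟨l, h₂, rfl⟩, _, ⟨l', h₄, rfl⟩, rfl⟩
  exact ⟨l ++ l', by rw [wordDegree_append, h₂, h₄], by simp⟩

theorem t_zero (i j : Fin n) : t K n i j 0 = if i = j then 1 else 0 := (isRTT_t K n).zero i j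

theorem t_mem_filtered (i j : Fin n) (r : ℕ) :
    t K n i j r ∈ filtered K (r + 1) (Pi.single i 1 - Pi.single j 1) := by
  rcases r with _ | r
  · rw [t_zero]
    split_ifs with h
    · subst h
      have := word_mem_filtered (K := K) (l := ([] : List (Fin n × Fin n × ℕ))) (m := 1) (by simp)
      simpa using this
    · exact zero_mem _
  · have := word_mem_filtered (K := K) (l := [(i, j, r)]) (m := r + 2) (by simp)
    simpa [genDegree] using this

/-- The defining relation trades `[t^(r+1), t^(s)]` for `[t^(r), t^(s+1)]` at the cost of products
of weight at most `r + s`. Repeating this ends at the scalar `t^(0)`. Hence the associated graded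
algebra is commutative. -/
theorem commutator_mem_filtered (i j k l : Fin n) (r s : ℕ) :
    t K n i j r * t K n k l s - t K n k l s * t K n i j r
      ∈ filtered K (r + s) (Pi.single i 1 - Pi.single j 1 + (Pi.single k 1 - Pi.single l 1)) := by
  induction r generalizing s with
  | zero =>
    rw [t_zero]
    split_ifs <;> simp
  | succ r ih =>
    rw [sub_eq_iff_eq_add.1 ((isRTT_t K n).rel i j k l r s)]
    refine add_mem (sub_mem ?_ ?_) (filtered_mono (by omega) _ (ih (s + 1)))
    · exact mul_mem_filtered (t_mem_filtered k j r) (t_mem_filtered i l s) (by omega) (by abel)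
    · exact mul_mem_filtered (t_mem_filtered k j s) (t_mem_filtered i l r) (by omega) (by abel)

theorem word_sub_word_mem_filtered {l l' : List (Fin n × Fin n × ℕ)} (h : l.Perm l') :
    word K l - word K l' ∈ filtered K (wordWeight l) (wordDegree l) := by
  induction h with
  | nil => simp
  | cons x h ih =>
    rw [word_cons, word_cons, ← mul_sub]
    refine mul_mem_filtered (t_mem_filtered _ _ _) ih ?_ ?_
    · simp only [wordWeight_cons]; omega
    · simp [genDegree]
  | swap x y l =>
    have : word K (y :: x :: l) - word K (x :: y :: l)
        = (t K n y.1 y.2.1 (y.2.2 + 1) * t K n x.1 x.2.1 (x.2.2 + 1)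
          - t K n x.1 x.2.1 (x.2.2 + 1) * t K n y.1 y.2.1 (y.2.2 + 1)) * word K l := by
      simp only [word_cons, sub_mul, mul_assoc]
    rw [this]
    refine mul_mem_filtered (commutator_mem_filtered _ _ _ _ _ _)
      (word_mem_filtered (Nat.lt_succ_self _)) ?_ ?_
    · simp only [wordWeight_cons]; omega
    · simp [genDegree, add_assoc]
  | trans h₁ h₂ ih₁ ih₂ =>
    rw [← wordWeight_perm h₁, ← wordDegree_perm h₁] at ih₂
    simpa using add_mem ih₁ ih₂

/-- Every word is a combination of words of the same degree in which the generators `t_ij^(r)`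
with `i < j` stand on the right. -/
theorem word_mem_span_ordered (l : List (Fin n × Fin n × ℕ)) :
    word K l ∈ Submodule.span K {y | ∃ a b : List (Fin n × Fin n × ℕ),
      (∀ x ∈ a, x.2.1 ≤ x.1) ∧ (∀ x ∈ b, x.1 < x.2.1) ∧ wordDegree (a ++ b) = wordDegree l ∧
      y = word K (a ++ b)} := by
  induction hm : wordWeight l using Nat.strong_induction_on generalizing l with
  | _ m ih =>
    -- Moving the raising letters to the right is a permutation of the word, so the error consists
    -- of words of smaller weight and the same degree, to which induction applies.
    have hp := (List.filter_append_perm (fun x : Fin n × Fin n × ℕ => decide (x.2.1 ≤ x.1)) l).symm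
    have h := word_sub_word_mem_filtered (K := K) hp
    rw [← sub_add_cancel (word K l) (word K _)]
    refine add_mem (Submodule.span_le.2 ?_ h) (Submodule.subset_span ⟨_, _, ?_, ?_,
      (wordDegree_perm hp).symm, rfl⟩)
    · rintro _ ⟨l', h₁, h₂, rfl⟩
      rw [← h₂]
      exact ih _ (hm ▸ h₁) _ rfl
    · intro x hx
      simpa using (List.mem_filter.1 hx).2
    · intro x hx
      simpa using (List.mem_filter.1 hx).2

/-- Only the spanning half of the grading is needed; independence of the components is replaced by
the torus action on a representation. -/
theorem mem_iSup_component (y : Yangian K n) :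
    y ∈ ⨆ d : Fin n → ℤ, component K d := by
  obtain ⟨x, rfl⟩ := RingQuot.mkAlgHom_surjective K (Rel K n) y
  induction x using FreeAlgebra.induction with
  | grade0 c =>
    rw [AlgHom.commutes, Algebra.algebraMap_eq_smul_one]
    exact Submodule.smul_mem _ _ (Submodule.mem_iSup_of_mem 0
      (by simpa using word_mem_component (K := K) ([] : List (Fin n × Fin n × ℕ))))
  | grade1 x =>
    refine Submodule.mem_iSup_of_mem (wordDegree [x]) ?_
    have := word_mem_component (K := K) [x]
    simpa [t, tFree] using this
  | mul a b ha hb =>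
    rw [map_mul]
    refine Submodule.iSup_induction _ (motive := fun x => x * _ ∈ _) ha ?_ (by simp) ?_
    · intro d x hx
      refine Submodule.iSup_induction _ (motive := fun y => x * y ∈ _) hb ?_ (by simp) ?_
      · exact fun e y hy => Submodule.mem_iSup_of_mem _ (mul_mem_component hx hy)
      · intro y z hy hz
        rw [mul_add]
        exact add_mem hy hz
    · intro y z hy hz
      rw [add_mul]
      exact add_mem hy hz
  | add a b ha hb => rw [map_add]; exact add_mem ha hb

end Ordering

/-! ### Separating degrees by characters of the torus -/

section Characters

variable {K : Type u} [Field K] {n : ℕ}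

/-- The character `z ↦ z^d` of the torus `(Kˣ)^n`. -/
def torusChar (K : Type u) [Field K] {n : ℕ} (d : Fin n → ℤ) : (Fin n → Kˣ) →* K where
  toFun z := ((∏ i, z i ^ d i : Kˣ) : K)
  map_one' := by simp
  map_mul' z w := by simp [mul_zpow, Finset.prod_mul_distrib]

@[simp] theorem torusChar_zero (z : Fin n → Kˣ) : torusChar K (0 : Fin n → ℤ) z = 1 := by
  simp [torusChar]

theorem torusChar_add (d e : Fin n → ℤ) (z : Fin n → Kˣ) :
    torusChar K (d + e) z = torusChar K d z * torusChar K e z := by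
  simp [torusChar, zpow_add, Finset.prod_mul_distrib]

theorem torusChar_root (i j : Fin n) (z : Fin n → Kˣ) :
    torusChar K (Pi.single i 1 - Pi.single j 1) z = ((z i / z j : Kˣ) : K) := by
  have h : ∀ i : Fin n, ∏ k, z k ^ (Pi.single i (1 : ℤ) : Fin n → ℤ) k = z i := by
    intro i
    rw [Finset.prod_eq_single i]
    · simp
    · intro k _ hk
      simp [hk]
    · simp
  change ((∏ k, z k ^ (_ : ℤ) : Kˣ) : K) = _
  simp only [Pi.sub_apply, zpow_sub, Finset.prod_mul_distrib, h, Finset.prod_inv_distrib]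
  rw [div_eq_mul_inv]

theorem exists_unit_zpow_ne_one [Infinite K] {m : ℤ} (hm : m ≠ 0) : ∃ x : Kˣ, x ^ m ≠ 1 := by
  by_contra! h
  have hf : (Polynomial.X ^ (m.natAbs + 1) - Polynomial.X : Polynomial K) = 0 := by
    refine Polynomial.funext fun x => ?_
    by_cases hx : x = 0
    · simp [hx]
    · have h₁ : (Units.mk0 x hx) ^ m.natAbs = 1 := by
        rcases Int.natAbs_eq m with h₂ | h₂
        · have := h (Units.mk0 x hx)
          rwa [h₂, zpow_natCast] at this
        · have := h (Units.mk0 x hx)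
          rwa [h₂, zpow_neg, inv_eq_one, zpow_natCast] at this
      have h₂ := congrArg (fun u : Kˣ => (u : K)) h₁
      simp only [Units.val_pow_eq_pow_val, Units.val_mk0, Units.val_one] at h₂
      simp [pow_succ, h₂]
  -- Otherwise `X^(|m|+1) - X` would vanish on an infinite field; it is a nonzero polynomial because
  -- `|m| + 1 > 1`.
  exact FiniteField.X_pow_card_sub_X_ne_zero K (by have := Int.natAbs_pos.2 hm; omega) hf

theorem torusChar_injective [Infinite K] :
    Function.Injective (torusChar K : (Fin n → ℤ) → (Fin n → Kˣ) →* K) := by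
  intro d e h
  by_contra hne
  obtain ⟨i, hi⟩ := Function.ne_iff.1 hne
  obtain ⟨x, hx⟩ := exists_unit_zpow_ne_one (K := K) (sub_ne_zero.2 hi)
  apply hx
  have key : ∀ d : Fin n → ℤ, ∏ k, (Pi.mulSingle i x : Fin n → Kˣ) k ^ d k = x ^ d i := by
    intro d
    rw [Finset.prod_eq_single i]
    · simp
    · intro k _ hk
      simp [hk]
    · simp
  have h₁ := DFunLike.congr_fun h (Pi.mulSingle i x)
  change ((∏ k, _ : Kˣ) : K) = ((∏ k, _ : Kˣ) : K) at h₁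
  rw [Units.val_inj, key, key] at h₁
  rw [zpow_sub, h₁, mul_inv_cancel]

/-- Apply any linear functional on `V ⧸ R`: a linear relation between distinct characters results,
and Dedekind's theorem makes every coefficient vanish. -/
theorem mem_of_sum_torusChar_smul_mem [Infinite K] {V : Type*} [AddCommGroup V] [Module K V]
    (R : Submodule K V) (F : Finset (Fin n → ℤ)) (w : (Fin n → ℤ) → V)
    (h : ∀ z, ∑ d ∈ F, torusChar K d z • w d ∈ R) : ∀ d ∈ F, w d ∈ R := by
  intro d hd
  rw [← Submodule.Quotient.mk_eq_zero, ← Module.forall_dual_apply_eq_zero_iff K]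
  intro f
  have hli := (linearIndependent_monoidHom (Fin n → Kˣ) K).comp _ (torusChar_injective (n := n))
  refine linearIndependent_iff'.1 hli F (fun d => f (R.mkQ (w d))) ?_ d hd
  funext z
  have h₁ := congrArg f ((Submodule.Quotient.mk_eq_zero R).2 (h z))
  change f (R.mkQ _) = _ at h₁
  simp only [map_sum, map_smul, smul_eq_mul, map_zero] at h₁
  simp only [Finset.sum_apply, Pi.smul_apply, Function.comp, smul_eq_mul, Pi.zero_apply]
  rw [← h₁]
  exact Finset.sum_congr rfl fun _ _ => mul_comm _ _

end Characters

/-! ### Action of components of nonnegative height on a singular vector -/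

section Height

variable {K : Type u} [Field K] {n : ℕ}

/-- The height on the root lattice for which `ε_i - ε_j` has height `j - i`. -/
def height (n : ℕ) : (Fin n → ℤ) →+ ℤ where
  toFun d := -∑ i : Fin n, (i : ℤ) * d i
  map_zero' := by simp
  map_add' d e := by simp [mul_add, Finset.sum_add_distrib]; ring

theorem height_genDegree (x : Fin n × Fin n × ℕ) :
    height n (genDegree x) = (x.2.1 : ℤ) - (x.1 : ℤ) := by
  have h : ∀ i : Fin n, height n (Pi.single i 1) = -(i : ℤ) := by
    intro i
    change -∑ k, _ = _
    rw [Finset.sum_eq_single i]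
    · simp
    · intro k _ hk
      simp [hk]
    · simp
  rw [genDegree, map_sub, h, h]
  ring

theorem height_wordDegree_nonpos {l : List (Fin n × Fin n × ℕ)} (h : ∀ x ∈ l, x.2.1 ≤ x.1) :
    height n (wordDegree l) ≤ 0 := by
  induction l with
  | nil => simp
  | cons x l ih =>
    have h₁ := ih fun y hy => h y (by simp [hy])
    have h₂ : (x.2.1 : ℕ) ≤ x.1 := h x (by simp)
    rw [wordDegree_cons, map_add, height_genDegree]
    omega

theorem diagonal_of_height_nonneg {l : List (Fin n × Fin n × ℕ)} (h : ∀ x ∈ l, x.2.1 ≤ x.1)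
    (h₀ : 0 ≤ height n (wordDegree l)) : ∀ x ∈ l, x.2.1 = x.1 := by
  induction l with
  | nil => simp
  | cons x l ih =>
    have h₁ := height_wordDegree_nonpos fun y hy => h y (List.mem_cons_of_mem x hy)
    have h₂ : (x.2.1 : ℕ) ≤ x.1 := h x (by simp)
    rw [wordDegree_cons, map_add, height_genDegree] at h₀
    intro y hy
    rcases List.mem_cons.1 hy with rfl | hy
    · ext; omega
    · exact ih (fun y hy => h y (List.mem_cons_of_mem x hy)) (by omega) y hy

variable {X : Type*} [AddCommGroup X] [Module (Yangian K n) X]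

/-- The rightmost letter is a raising one and acts first, already sending `x` into `Q`. -/
theorem word_smul_mem {Q : Submodule (Yangian K n) X} {x : X}
    (hx : ∀ (i j : Fin n) (r : ℕ), i < j → t K n i j (r + 1) • x ∈ Q)
    (a : List (Fin n × Fin n × ℕ)) {b : List (Fin n × Fin n × ℕ)} (hb : ∀ x ∈ b, x.1 < x.2.1)
    (hne : b ≠ []) : word K (a ++ b) • x ∈ Q := by
  rw [← List.dropLast_append_getLast hne, ← List.append_assoc, word_append, mul_smul]
  refine Q.smul_mem _ ?_
  simpa using hx _ _ _ (hb _ (List.getLast_mem hne))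

variable [Module K X] [IsScalarTower K (Yangian K n) X]

theorem smul_mem_of_mem_span {S : Set (Yangian K n)} (Q : Submodule K X) {x : X}
    (h : ∀ y ∈ S, y • x ∈ Q) {y : Yangian K n} (hy : y ∈ Submodule.span K S) : y • x ∈ Q := by
  induction hy using Submodule.span_induction with
  | mem y hy => exact h y hy
  | zero => simp
  | add y z _ _ hy hz => rw [add_smul]; exact add_mem hy hz
  | smul c y _ hy => rw [smul_assoc]; exact Q.smul_mem c hy

theorem smul_mem_of_mem_component (Q : Submodule K X) {x : X} {d : Fin n → ℤ}
    (h : ∀ a b : List (Fin n × Fin n × ℕ), (∀ x ∈ a, x.2.1 ≤ x.1) → (∀ x ∈ b, x.1 < x.2.1) →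
      wordDegree (a ++ b) = d → word K (a ++ b) • x ∈ Q)
    {y : Yangian K n} (hy : y ∈ component K d) : y • x ∈ Q := by
  refine smul_mem_of_mem_span Q ?_ hy
  rintro _ ⟨l, rfl, rfl⟩
  refine smul_mem_of_mem_span Q ?_ (word_mem_span_ordered l)
  rintro _ ⟨a, b, ha, hb, hd, rfl⟩
  exact h a b ha hb hd

/-- Letters `t_ij` with `j ≤ i` have height at most `0`, so an ordered word of positive height must
end in a raising letter. The general `Q` allows vectors that are singular only modulo the radical.
-/
theorem smul_mem_of_height_pos {Q : Submodule (Yangian K n) X} {x : X}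
    (hx : ∀ (i j : Fin n) (r : ℕ), i < j → t K n i j (r + 1) • x ∈ Q) {d : Fin n → ℤ}
    (hd : 0 < height n d) {y : Yangian K n} (hy : y ∈ component K d) : y • x ∈ Q := by
  refine smul_mem_of_mem_component (Q.restrictScalars K) ?_ hy
  intro a b ha hb h
  by_cases hne : b = []
  · subst hne
    have := height_wordDegree_nonpos ha
    rw [List.append_nil] at h
    rw [h] at this
    omega
  · exact word_smul_mem hx a hb hne

/-- An ordered word either ends in a raising letter and kills `x`, or has no raising letter; in the
latter case nonnegative height forces all letters to be diagonal, and these scale `x`. -/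
theorem smul_mem_span_of_height_nonneg {x : X} (c : Fin n → ℕ → K)
    (hx : ∀ (i j : Fin n) (r : ℕ), i < j → t K n i j (r + 1) • x = 0)
    (hc : ∀ (i : Fin n) (r : ℕ), t K n i i (r + 1) • x = c i (r + 1) • x) {d : Fin n → ℤ}
    (hd : 0 ≤ height n d) {y : Yangian K n} (hy : y ∈ component K d) :
    y • x ∈ Submodule.span K {x} := by
  refine smul_mem_of_mem_component _ ?_ hy
  intro a b ha hb h
  by_cases hne : b = []
  · subst hne
    rw [List.append_nil] at h ⊢
    have hdiag := diagonal_of_height_nonneg ha (h ▸ hd)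
    clear ha h
    induction a with
    | nil => simp
    | cons z l ih =>
      obtain ⟨e, he⟩ := Submodule.mem_span_singleton.1
        (ih fun y hy => hdiag y (List.mem_cons_of_mem z hy))
      rw [word_cons, mul_smul, ← he, hdiag z (by simp), algebra_compatible_smul (Yangian K n) e,
        ← mul_smul, ← Algebra.commutes, mul_smul, ← algebra_compatible_smul, hc]
      exact Submodule.smul_mem _ _ (Submodule.smul_mem _ _ (Submodule.mem_span_singleton_self x))
  · have := word_smul_mem (Q := ⊥) (x := x) (by simpa using hx) a hb hne
    rw [(Submodule.mem_bot _).1 this]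
    exact zero_mem _

end Height

/-! ### The Verma module, its components and its graded submodules -/

section Verma

variable {K : Type u} [Field K] {n : ℕ} {μ : Fin n → PowerSeries K}

/-- The canonical generator of the Verma module. -/
noncomputable def vermaVector (μ : Fin n → PowerSeries K) : Verma μ := (vermaIdeal μ).mkQ 1

theorem verma_smul_eq (c : K) (m : Verma μ) : c • m = algebraMap K (Yangian K n) c • m :=
  algebra_compatible_smul _ c m

theorem smul_vermaVector (y : Yangian K n) : y • vermaVector μ = (vermaIdeal μ).mkQ y := by
  rw [vermaVector, ← map_smul, smul_eq_mul, mul_one]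

theorem upper_smul_vermaVector (i j : Fin n) (r : ℕ) (h : i < j) :
    t K n i j (r + 1) • vermaVector μ = 0 := by
  rw [smul_vermaVector, Submodule.mkQ_apply, Submodule.Quotient.mk_eq_zero]
  exact Submodule.subset_span (Or.inl ⟨i, j, r, h, rfl⟩)

theorem diag_smul_vermaVector (i : Fin n) (r : ℕ) :
    t K n i i (r + 1) • vermaVector μ = PowerSeries.coeff (r + 1) (μ i) • vermaVector μ := by
  rw [verma_smul_eq, smul_vermaVector, smul_vermaVector, ← sub_eq_zero, ← map_sub,
    Submodule.mkQ_apply, Submodule.Quotient.mk_eq_zero]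
  exact Submodule.subset_span (Or.inr ⟨i, r, rfl⟩)

theorem vermaComponent_eq (d : Fin n → ℤ) :
    vermaComponent μ d = (component K d).map ((vermaIdeal μ).mkQ.restrictScalars K) := by
  rw [vermaComponent, component, Submodule.map_span]
  congr 1
  ext x
  constructor
  · rintro ⟨l, h, rfl⟩
    exact ⟨_, ⟨l, h, rfl⟩, rfl⟩
  · rintro ⟨_, ⟨l, h, rfl⟩, rfl⟩
    exact ⟨l, h, rfl⟩

theorem mem_vermaComponent {d : Fin n → ℤ} {m : Verma μ} :
    m ∈ vermaComponent μ d ↔ ∃ y ∈ component K d, y • vermaVector μ = m := by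
  rw [vermaComponent_eq]
  simp only [Submodule.mem_map, smul_vermaVector]
  rfl

theorem vermaVector_mem : vermaVector μ ∈ vermaComponent μ 0 :=
  mem_vermaComponent.2 ⟨1, by simpa using word_mem_component (K := K) ([] : List (Fin n × Fin n × ℕ)),
    one_smul _ _⟩

theorem smul_mem_vermaComponent {d e : Fin n → ℤ} {y : Yangian K n} (hy : y ∈ component K d)
    {m : Verma μ} (hm : m ∈ vermaComponent μ e) : y • m ∈ vermaComponent μ (d + e) := by
  obtain ⟨y', hy', rfl⟩ := mem_vermaComponent.1 hm
  exact mem_vermaComponent.2 ⟨y * y', mul_mem_component hy hy', mul_smul _ _ _⟩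

theorem exists_sum_component (y : Yangian K n) : ∃ (F : Finset (Fin n → ℤ))
    (f : (Fin n → ℤ) → Yangian K n), (∀ d, f d ∈ component K d) ∧ ∑ d ∈ F, f d = y := by
  obtain ⟨f, hf, h⟩ := (Submodule.mem_iSup_iff_exists_finsupp _ _).1 (mem_iSup_component y)
  exact ⟨f.support, f, hf, h⟩

theorem exists_sum_vermaComponent (m : Verma μ) : ∃ (F : Finset (Fin n → ℤ))
    (f : (Fin n → ℤ) → Verma μ), (∀ d, f d ∈ vermaComponent μ d) ∧ ∑ d ∈ F, f d = m := by
  obtain ⟨y, rfl⟩ := (vermaIdeal μ).mkQ_surjective m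
  obtain ⟨F, f, hf, rfl⟩ := exists_sum_component y
  exact ⟨F, fun d => f d • vermaVector μ, fun d => mem_vermaComponent.2 ⟨_, hf d, rfl⟩, by
    rw [← Finset.sum_smul, smul_vermaVector]⟩

theorem eq_zero_of_height_pos {d : Fin n → ℤ} (hd : 0 < height n d) {m : Verma μ}
    (hm : m ∈ vermaComponent μ d) : m = 0 := by
  obtain ⟨y, hy, rfl⟩ := mem_vermaComponent.1 hm
  rw [← Submodule.mem_bot (Yangian K n)]
  exact smul_mem_of_height_pos (fun i j r h => by simp [upper_smul_vermaVector i j r h]) hd hy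

theorem mem_span_vermaVector {d : Fin n → ℤ} (hd : 0 ≤ height n d) {m : Verma μ}
    (hm : m ∈ vermaComponent μ d) : m ∈ Submodule.span K {vermaVector μ} := by
  obtain ⟨y, hy, rfl⟩ := mem_vermaComponent.1 hm
  exact smul_mem_span_of_height_nonneg (fun i r => PowerSeries.coeff r (μ i))
    upper_smul_vermaVector diag_smul_vermaVector hd hy

theorem eq_top_of_vermaVector_mem {N : Submodule (Yangian K n) (Verma μ)}
    (h : vermaVector μ ∈ N) : N = ⊤ := by
  refine eq_top_iff.2 fun m _ => ?_
  obtain ⟨y, rfl⟩ := (vermaIdeal μ).mkQ_surjective m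
  rw [← smul_vermaVector]
  exact N.smul_mem y h

theorem isGraded_span {S : Set (Verma μ)} (hS : ∀ m ∈ S, ∃ d, m ∈ vermaComponent μ d) :
    IsGraded (Submodule.span (Yangian K n) S) :=
  le_antisymm (Submodule.span_le.2 fun _ h => h.1)
    (Submodule.span_mono fun m hm => ⟨Submodule.subset_span hm, hS m hm⟩)

theorem isGraded_sSup {S : Set (Submodule (Yangian K n) (Verma μ))} (hS : ∀ N ∈ S, IsGraded N) :
    IsGraded (sSup S) := by
  refine le_antisymm (Submodule.span_le.2 fun _ h => h.1) (sSup_le fun N hN => ?_)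
  exact (hS N hN).symm.le.trans
    (Submodule.span_mono fun m h => ⟨le_sSup (a := N) hN h.1, h.2⟩)

theorem isGraded_vermaRadical : IsGraded (vermaRadical μ) :=
  isGraded_sSup fun _ h => h.1

theorem smul_mem_span_homogeneous (N : Submodule (Yangian K n) (Verma μ)) (y : Yangian K n)
    {m : Verma μ} (hm : m ∈ Submodule.span K {x | x ∈ N ∧ ∃ d, x ∈ vermaComponent μ d}) :
    y • m ∈ Submodule.span K {x | x ∈ N ∧ ∃ d, x ∈ vermaComponent μ d} := by
  induction hm using Submodule.span_induction with
  | mem x hx =>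
    obtain ⟨F, f, hf, rfl⟩ := exists_sum_component y
    obtain ⟨h₁, e, h₂⟩ := hx
    rw [Finset.sum_smul]
    exact sum_mem fun d _ => Submodule.subset_span
      ⟨N.smul_mem _ h₁, _, smul_mem_vermaComponent (hf d) h₂⟩
  | zero => rw [smul_zero]; exact zero_mem _
  | add x y _ _ hx hy => rw [smul_add]; exact add_mem hx hy
  | smul c x _ hx =>
    have h : y • c • x = c • y • x := by
      rw [verma_smul_eq, verma_smul_eq, ← mul_smul, ← Algebra.commutes, mul_smul]
    rw [h]
    exact Submodule.smul_mem _ _ hx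

/-- Gradedness is defined by generation over the Yangian. The `K`-span of the homogeneous elements
is already stable under the Yangian, so it suffices. -/
theorem IsGraded.mem_span {N : Submodule (Yangian K n) (Verma μ)} (hN : IsGraded N)
    {m : Verma μ} (hm : m ∈ N) :
    m ∈ Submodule.span K {x | x ∈ N ∧ ∃ d, x ∈ vermaComponent μ d} := by
  rw [← hN] at hm
  induction hm using Submodule.span_induction with
  | mem x hx => exact Submodule.subset_span hx
  | zero => exact zero_mem _
  | add x y _ _ hx hy => exact add_mem hx hy
  | smul y x _ hx => exact smul_mem_span_homogeneous N y hx

end Verma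

end Yangian

/-! ### Highest weight vectors and the map from the Verma module -/

namespace YangianRep

variable {K : Type u} [Field K] {n : ℕ}

open Yangian

/-- `v` is a highest weight vector of weight `μ(u)`, and the algebraic torus of `GL_n` acts on the
representation compatibly with the root lattice grading of the Yangian, fixing `v`. -/
structure IsHighestWeight {V : Type*} [AddCommGroup V] [Module K V]
    (ρ : Yangian K n →ₐ[K] Module.End K V) (v : V) (μ : Fin n → PowerSeries K) : Prop where
  ne_zero : v ≠ 0
  upper : ∀ i j r, i < j → ρ (t K n i j r) v = 0
  diag : ∀ i r, ρ (t K n i i r) v = PowerSeries.coeff r (μ i) • v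
  torus : ∃ τ : (Fin n → Kˣ) → Module.End K V,
    (∀ z i j r (x : V), τ z (ρ (t K n i j r) x)
      = ((z i / z j : Kˣ) : K) • ρ (t K n i j r) (τ z x)) ∧ ∀ z, τ z v = v

theorem smul_def (W : YangianRep K n) (y : Yangian K n) (x : W.V) : y • x = W.ρ y x := rfl

instance (W : YangianRep K n) : IsScalarTower K (Yangian K n) W.V where
  smul_assoc c y x := by simp only [smul_def, map_smul, LinearMap.smul_apply]

theorem torus_apply {W : YangianRep K n} {τ : (Fin n → Kˣ) → Module.End K W.V}
    (hτ : ∀ z i j r (x : W.V), τ z (W.ρ (t K n i j r) x)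
      = ((z i / z j : Kˣ) : K) • W.ρ (t K n i j r) (τ z x))
    {d : Fin n → ℤ} {y : Yangian K n} (hy : y ∈ component K d) (z : Fin n → Kˣ) (x : W.V) :
    τ z (W.ρ y x) = torusChar K d z • W.ρ y (τ z x) := by
  induction hy using Submodule.span_induction with
  | mem y hy =>
    obtain ⟨l, rfl, rfl⟩ := hy
    induction l with
    | nil => simp
    | cons a l ih =>
      simp only [word_cons, map_mul, Module.End.mul_apply, hτ, ih, wordDegree_cons, torusChar_add,
        genDegree, torusChar_root, map_smul, mul_smul]
  | zero => simp
  | add y y' _ _ h h' => simp only [map_add, LinearMap.add_apply, h, h', smul_add]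
  | smul c y _ h => simp only [map_smul, LinearMap.smul_apply, h]; rw [smul_comm]

namespace IsHighestWeight

variable {W : YangianRep K n} {v : W.V} {μ : Fin n → PowerSeries K}

/-- The homomorphism from the Verma module given by a highest weight vector. -/
noncomputable def hom (h : IsHighestWeight W.ρ v μ) : Verma μ →ₗ[Yangian K n] W.V :=
  (vermaIdeal μ).liftQ (LinearMap.toSpanSingleton (Yangian K n) W.V v) <| by
    rw [vermaIdeal, Submodule.span_le]
    rintro _ (⟨i, j, r, hij, rfl⟩ | ⟨i, r, rfl⟩)
    · exact h.upper i j (r + 1) hij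
    · rw [SetLike.mem_coe, LinearMap.mem_ker, LinearMap.toSpanSingleton_apply, smul_def, map_sub,
        LinearMap.sub_apply, h.diag, AlgHom.commutes, Module.algebraMap_end_apply, sub_self]

theorem hom_vermaVector (h : IsHighestWeight W.ρ v μ) : h.hom (vermaVector μ) = v := by
  rw [vermaVector, hom, Submodule.mkQ_apply, Submodule.liftQ_apply,
    LinearMap.toSpanSingleton_apply, one_smul]

theorem hom_smul_vermaVector (h : IsHighestWeight W.ρ v μ) (y : Yangian K n) :
    h.hom (y • vermaVector μ) = W.ρ y v := by
  rw [map_smul, hom_vermaVector, smul_def]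

theorem hom_smul (h : IsHighestWeight W.ρ v μ) (c : K) (m : Verma μ) : h.hom (c • m) = c • h.hom m := by
  rw [verma_smul_eq, map_smul, algebraMap_smul]

/-- The torus acts on the image of the component of degree `d` by the character of `d`, so a
torus-stable `R` contains the homogeneous parts of its elements. The shift `e` lets a whole family
be moved by a generator without reindexing. -/
theorem mem_of_sum_mem [Infinite K] (h : IsHighestWeight W.ρ v μ) (R : Submodule K W.V)
    (hR : ∀ τ : (Fin n → Kˣ) → Module.End K W.V,
      (∀ d, ∀ m ∈ vermaComponent μ d, ∀ z, τ z (h.hom m) = torusChar K d z • h.hom m) →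
      ∀ z, ∀ x ∈ R, τ z x ∈ R)
    (F : Finset (Fin n → ℤ)) (e : Fin n → ℤ) (f : (Fin n → ℤ) → Verma μ)
    (hf : ∀ d, f d ∈ vermaComponent μ (d + e)) (hs : ∑ d ∈ F, h.hom (f d) ∈ R) :
    ∀ d ∈ F, h.hom (f d) ∈ R := by
  obtain ⟨τ, hτ, hv⟩ := h.torus
  have key : ∀ d, ∀ m ∈ vermaComponent μ d, ∀ z, τ z (h.hom m) = torusChar K d z • h.hom m := by
    intro d m hm z
    obtain ⟨y, hy, rfl⟩ := mem_vermaComponent.1 hm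
    rw [hom_smul_vermaVector, torus_apply hτ hy, hv]
  refine mem_of_sum_torusChar_smul_mem R F _ fun z => ?_
  -- Dividing by the common character of `e` leaves the characters of the `d` in `F`.
  have h₁ := R.smul_mem (torusChar K e z)⁻¹ (hR τ key z _ hs)
  have h₂ : torusChar K e z ≠ 0 := Units.ne_zero _
  have h₃ : ∀ d, torusChar K d z • h.hom (f d)
      = (torusChar K e z)⁻¹ • (τ z (h.hom (f d))) := by
    intro d
    rw [key _ _ (hf d), torusChar_add, mul_comm, mul_smul, inv_smul_smul₀ h₂]
  simp only [h₃, ← Finset.smul_sum, ← map_sum]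
  rwa [map_sum]

/-- The torus makes the kernel graded (take `R = ⊥`), and it is proper because `v ≠ 0`. -/
theorem ker_hom_le [Infinite K] (h : IsHighestWeight W.ρ v μ) :
    LinearMap.ker h.hom ≤ vermaRadical μ := by
  refine le_sSup ⟨?_, ?_⟩
  · refine le_antisymm (Submodule.span_le.2 fun _ h => h.1) fun m hm => ?_
    obtain ⟨F, f, hf, rfl⟩ := exists_sum_vermaComponent m
    rw [LinearMap.mem_ker, map_sum] at hm
    have h₁ := h.mem_of_sum_mem ⊥ (by simp +contextual) F 0 f (by simpa using hf) (by simp [hm])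
    exact sum_mem fun d hd => Submodule.subset_span ⟨by simpa using h₁ d hd, d, hf d⟩
  · intro htop
    apply h.ne_zero
    rw [← h.hom_vermaVector, ← LinearMap.mem_ker, htop]
    trivial

/-- Separate degrees inside the image of the radical in `W`, which is torus-stable; the result lifts
back because the kernel lies in the radical. -/
theorem mem_vermaRadical_of_sum_mem [Infinite K] (h : IsHighestWeight W.ρ v μ)
    (F : Finset (Fin n → ℤ)) (e : Fin n → ℤ) (f : (Fin n → ℤ) → Verma μ)
    (hf : ∀ d, f d ∈ vermaComponent μ (d + e)) (hs : ∑ d ∈ F, f d ∈ vermaRadical μ) :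
    ∀ d ∈ F, f d ∈ vermaRadical μ := by
  intro d hd
  have h₁ : h.hom (f d) ∈ ((vermaRadical μ).map h.hom).restrictScalars K := by
    refine h.mem_of_sum_mem _ ?_ F e f hf ?_ d hd
    · rintro τ hτ z _ ⟨m, hm, rfl⟩
      have hm := isGraded_vermaRadical.mem_span hm
      rename_i hm₀
      clear hm₀
      induction hm using Submodule.span_induction with
      | mem m hm =>
        obtain ⟨hm, d, hd⟩ := hm
        rw [hτ d m hd]
        exact Submodule.smul_mem _ _ (Submodule.mem_map_of_mem hm)
      | zero => simp
      | add m m' _ _ h₁ h₂ =>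
        rw [map_add, map_add]
        exact add_mem h₁ h₂
      | smul c m _ h₁ =>
        rw [h.hom_smul, map_smul]
        exact Submodule.smul_mem _ _ h₁
    · rw [← map_sum]
      exact Submodule.mem_map_of_mem hs
  obtain ⟨m, hm, h₂⟩ := h₁
  rw [← sub_add_cancel (f d) m]
  refine add_mem (h.ker_hom_le ?_) hm
  rw [LinearMap.mem_ker, map_sub, h₂, sub_self]

end IsHighestWeight

end YangianRep

/-! ### Absence of degree zero from the radical -/

namespace Yangian

variable {K : Type u} [Field K] {n : ℕ} {μ : Fin n → PowerSeries K}

/-- In degree zero only multiples of the generator occur, and a nonzero one would make a graded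
submodule everything. -/
theorem mem_span_of_mem_vermaRadical {x : Verma μ} (hx : x ∈ vermaRadical μ) :
    x ∈ Submodule.span K {x | ∃ d ≠ 0, x ∈ vermaComponent μ d} := by
  rw [vermaRadical, sSup_eq_iSup'] at hx
  induction hx using Submodule.iSup_induction' with
  | mem N m hm =>
    refine Submodule.span_le.2 ?_ (N.2.1.mem_span hm)
    rintro x ⟨hx, d, hd⟩
    by_cases h₀ : d = 0
    · subst h₀
      obtain ⟨c, rfl⟩ := Submodule.mem_span_singleton.1 (mem_span_vermaVector (by simp) hd)
      by_cases hc : c = 0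
      · rw [hc, zero_smul K (vermaVector μ)]
        exact zero_mem _
      · refine absurd (eq_top_of_vermaVector_mem ?_) N.2.2
        have := (N : Submodule (Yangian K n) (Verma μ)).smul_mem
          (algebraMap K (Yangian K n) c⁻¹) hx
        rwa [← verma_smul_eq, inv_smul_smul₀ hc] at this
    · exact Submodule.subset_span ⟨d, h₀, hd⟩
  | zero => exact zero_mem _
  | add x y _ _ hx hy => exact add_mem hx hy

theorem exists_sum_of_mem_span {x : Verma μ}
    (hx : x ∈ Submodule.span K {x | ∃ d ≠ 0, x ∈ vermaComponent μ d}) :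
    ∃ (F : Finset (Fin n → ℤ)) (f : (Fin n → ℤ) → Verma μ),
      (∀ d, f d ∈ vermaComponent μ d) ∧ f 0 = 0 ∧ ∑ d ∈ F, f d = x := by
  induction hx using Submodule.span_induction with
  | mem x hx =>
    obtain ⟨d, hd, hx⟩ := hx
    refine ⟨{d}, Pi.single d x, fun e => ?_, by simp [Ne.symm hd], by simp⟩
    by_cases he : e = d
    · subst he; simpa using hx
    · simp [he]
  | zero => exact ⟨∅, 0, fun _ => zero_mem _, rfl, rfl⟩
  | add x y _ _ hx hy =>
    obtain ⟨F, f, hf, h₁, rfl⟩ := hx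
    obtain ⟨G, g, hg, h₂, rfl⟩ := hy
    refine ⟨F ∪ G, fun d => (if d ∈ F then f d else 0) + (if d ∈ G then g d else 0),
      fun d => ?_, by simp [h₁, h₂], ?_⟩
    · refine add_mem ?_ ?_
      · split_ifs; exacts [hf d, zero_mem _]
      · split_ifs; exacts [hg d, zero_mem _]
    · rw [Finset.sum_add_distrib, Finset.sum_ite_mem, Finset.sum_ite_mem,
        Finset.union_inter_cancel_left, Finset.union_inter_cancel_right]
  | smul c x _ hx =>
    obtain ⟨F, f, hf, h₁, rfl⟩ := hx
    exact ⟨F, fun d => c • f d, fun d => Submodule.smul_mem _ _ (hf d),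
      (congrArg (c • ·) h₁).trans
        (map_zero (DistribSMul.toAddMonoidHom (Verma μ) c)),
      (map_sum (DistribSMul.toAddMonoidHom (Verma μ) c) f F).symm⟩

end Yangian

/-! ### Irreducibility of the quotient by the radical -/

namespace YangianRep.IsHighestWeight

open Yangian

variable {K : Type u} [Field K] {n : ℕ} {W : YangianRep K n} {v : W.V} {μ : Fin n → PowerSeries K}

/-- Otherwise the generator would be a sum of vectors of nonzero degree; comparing the parts of
degree zero in `W` gives `v = 0`. -/
theorem vermaVector_not_mem [Infinite K] (h : IsHighestWeight W.ρ v μ) :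
    vermaVector μ ∉ vermaRadical μ := by
  intro hmem
  obtain ⟨F, f, hf, h₀, hs⟩ := exists_sum_of_mem_span (mem_span_of_mem_vermaRadical hmem)
  apply h.ne_zero
  have h₃ := h.mem_of_sum_mem ⊥ (by simp +contextual) (insert 0 F) 0
    (fun d => f d - if d = 0 then vermaVector μ else 0) ?_ ?_ 0 (by simp)
  · simpa [h₀, h.hom_vermaVector] using h₃
  · intro d
    rw [add_zero]
    refine sub_mem (hf d) ?_
    by_cases hd : d = 0
    · subst hd; simpa using vermaVector_mem
    · simp [hd]
  · have : ∑ d ∈ insert 0 F, f d = vermaVector μ := by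
      rw [← hs, Finset.sum_insert_of_eq_zero_if_notMem fun _ => h₀]
    rw [← map_sum, Finset.sum_sub_distrib, this, Finset.sum_ite_eq']
    simp

theorem le_vermaRadical {N : Submodule (Yangian K n) (Verma μ)} (hN : IsGraded N)
    (h : vermaVector μ ∉ N) : N ≤ vermaRadical μ :=
  le_sSup ⟨hN, fun ht => h (ht ▸ Submodule.mem_top)⟩

/-- A homogeneous vector which is annihilated by the `t_ij^(r)` with `i < j` in the quotient by
the radical is a multiple of the highest weight vector there. -/
theorem mem_sup_of_singular [Infinite K] (h : IsHighestWeight W.ρ v μ) {d : Fin n → ℤ} {m : Verma μ}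
    (hm : m ∈ vermaComponent μ d)
    (hs : ∀ (i j : Fin n) (r : ℕ), i < j → t K n i j (r + 1) • m ∈ vermaRadical μ) :
    m ∈ (vermaRadical μ).restrictScalars K ⊔ Submodule.span K {vermaVector μ} := by
  by_cases hd : 0 ≤ height n d
  · exact Submodule.mem_sup_right (mem_span_vermaVector hd hm)
  refine Submodule.mem_sup_left ?_
  have hgr : IsGraded (vermaRadical μ ⊔ Submodule.span (Yangian K n) {m}) := by
    rw [← sSup_pair]
    refine isGraded_sSup ?_
    rintro N (rfl | rfl)
    · exact isGraded_vermaRadical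
    · exact isGraded_span fun x hx => ⟨d, by rwa [Set.mem_singleton_iff.1 hx]⟩
  refine le_vermaRadical hgr ?_ (Submodule.mem_sup_right (Submodule.mem_span_singleton_self m))
  -- Write the generator as `r + y • m` with `r` in the radical. Its part of degree zero involves
  -- only `f (-d) • m`, which lies in the radical since `-d` has positive height; so the generator
  -- would lie there too.
  intro hv
  obtain ⟨r, hr, _, hy, hry⟩ := Submodule.mem_sup.1 hv
  obtain ⟨y, rfl⟩ := Submodule.mem_span_singleton.1 hy
  obtain ⟨F, f, hf, rfl⟩ := exists_sum_component y
  have hpos : f (-d) • m ∈ vermaRadical μ :=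
    smul_mem_of_height_pos hs (by rw [map_neg]; omega) (hf (-d))
  have h₁ := h.mem_vermaRadical_of_sum_mem (insert (-d) F) d
    (fun e => (if e ∈ F then f e • m else 0) - if e = -d then vermaVector μ else 0) ?_ ?_
    (-d) (by simp)
  · refine h.vermaVector_not_mem ?_
    have h₂ : (if -d ∈ F then f (-d) • m else 0) ∈ vermaRadical μ := by
      split_ifs
      exacts [hpos, zero_mem _]
    simpa using sub_mem h₂ h₁
  · intro e
    refine sub_mem ?_ ?_
    · split_ifs
      exacts [smul_mem_vermaComponent (hf e) hm, zero_mem _]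
    · split_ifs with he
      · subst he
        simpa using vermaVector_mem
      · exact zero_mem _
  · rw [Finset.sum_sub_distrib, Finset.sum_ite_mem, Finset.sum_ite_eq',
      Finset.inter_eq_right.2 (Finset.subset_insert _ _), if_pos (Finset.mem_insert_self _ _),
      ← Finset.sum_smul, ← hry, sub_add_cancel_right]
    exact neg_mem hr

/-- Induction on a bound for the depth. Raising operators keep `x` in `N` and reduce its depth, so
they send it into the radical. `N` need not be graded: the homogeneous parts are compared only after
landing in the radical, which is. -/
theorem mem_vermaRadical_of_depth [Infinite K] (h : IsHighestWeight W.ρ v μ)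
    {N : Submodule (Yangian K n) (Verma μ)} (hN : vermaRadical μ ≤ N) (hv : vermaVector μ ∉ N)
    (k : ℕ) (F : Finset (Fin n → ℤ)) (e : Fin n → ℤ) (f : (Fin n → ℤ) → Verma μ)
    (hf : ∀ d, f d ∈ vermaComponent μ (d + e)) (hF : ∀ d ∈ F, -(k : ℤ) < height n (d + e))
    (hx : ∑ d ∈ F, f d ∈ N) : ∑ d ∈ F, f d ∈ vermaRadical μ := by
  induction k generalizing e f with
  | zero =>
    refine sum_mem fun d hd => ?_
    rw [eq_zero_of_height_pos (by simpa using hF d hd) (hf d)]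
    exact zero_mem _
  | succ k ih =>
    have hs : ∀ (i j : Fin n) (r : ℕ), i < j → ∀ d ∈ F, t K n i j (r + 1) • f d ∈ vermaRadical μ := by
      intro i j r hij
      have hdeg : ∀ d, t K n i j (r + 1) • f d ∈ vermaComponent μ (d + (e + genDegree (i, j, r))) := by
        intro d
        have := smul_mem_vermaComponent (word_mem_component (K := K) [(i, j, r)]) (hf d)
        simpa [add_comm, add_left_comm] using this
      refine h.mem_vermaRadical_of_sum_mem F _ (fun d => t K n i j (r + 1) • f d) hdeg
        (ih _ _ hdeg ?_ ?_)
      · intro d hd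
        have h₁ := hF d hd
        have h₂ : height n (genDegree (i, j, r)) = (j : ℤ) - (i : ℤ) := height_genDegree _
        have h₃ : (i : ℕ) < j := hij
        rw [← add_assoc, map_add, h₂]
        push_cast at h₁
        omega
      · rw [← Finset.smul_sum]
        exact N.smul_mem _ hx
    -- Each part is singular modulo the radical, so `x = r + c • vermaVector μ`; a nonzero `c` would
    -- put the generator into `N`.
    have h₁ : ∑ d ∈ F, f d ∈ (vermaRadical μ).restrictScalars K ⊔ Submodule.span K {vermaVector μ} :=
      sum_mem fun d hd => h.mem_sup_of_singular (hf d) fun i j r hij => hs i j r hij d hd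
    obtain ⟨r, hr, _, hc, hrc⟩ := Submodule.mem_sup.1 h₁
    obtain ⟨c, rfl⟩ := Submodule.mem_span_singleton.1 hc
    by_cases hc₀ : c = 0
    · rw [← hrc, hc₀, zero_smul K (vermaVector μ), add_zero]
      exact hr
    · refine absurd ?_ hv
      have h₂ : c • vermaVector μ ∈ N := by
        rw [← add_sub_cancel_left r (c • vermaVector μ), hrc]
        exact sub_mem hx (hN hr)
      have h₃ := N.smul_mem (algebraMap K (Yangian K n) c⁻¹) h₂
      rwa [← verma_smul_eq, inv_smul_smul₀ hc₀ (vermaVector μ)] at h₃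

theorem isSimpleModule [Infinite K] (h : IsHighestWeight W.ρ v μ) :
    IsSimpleModule (Yangian K n) (IrredHW μ) := by
  rw [isSimpleModule_iff_isCoatom]
  refine ⟨fun ht => h.vermaVector_not_mem (ht ▸ Submodule.mem_top), fun N hN => ?_⟩
  by_contra hne
  obtain ⟨x, hx, hxr⟩ := SetLike.exists_of_lt hN
  apply hxr
  obtain ⟨F, f, hf, rfl⟩ := exists_sum_vermaComponent x
  obtain ⟨k, hk⟩ : ∃ k : ℕ, ∀ d ∈ F, -(k : ℤ) < height n d := by
    refine ⟨∑ d ∈ F, ((height n d).natAbs + 1), fun d hd => ?_⟩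
    have := Finset.single_le_sum (f := fun d => (height n d).natAbs + 1) (fun _ _ => Nat.zero_le _) hd
    omega
  exact h.mem_vermaRadical_of_depth hN.le (fun hv => hne (eq_top_of_vermaVector_mem hv)) k F 0 f
    (by simpa using hf) (by simpa using hk) hx

/-- The irreducible highest weight module is a quotient of the submodule generated by a highest
weight vector. -/
theorem exists_surjective [Infinite K] (h : IsHighestWeight W.ρ v μ) :
    ∃ f : LinearMap.range h.hom →ₗ[Yangian K n] IrredHW μ, Function.Surjective f :=
  ⟨(Submodule.factor h.ker_hom_le).comp h.hom.quotKerEquivRange.symm.toLinearMap,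
    (Submodule.factor_surjective h.ker_hom_le).comp h.hom.quotKerEquivRange.symm.surjective⟩

theorem isSubquotient [Infinite K] (h : IsHighestWeight W.ρ v μ) : IsSubquotient (IrredHW μ) W :=
  ⟨_, h.exists_surjective⟩

theorem finite [Infinite K] [Module.Finite K W.V] (h : IsHighestWeight W.ρ v μ) :
    Module.Finite K (IrredHW μ) := by
  obtain ⟨f, hf⟩ := h.exists_surjective
  have : Module.Finite K (LinearMap.range h.hom) :=
    inferInstanceAs (Module.Finite K ((LinearMap.range h.hom).restrictScalars K))
  exact Module.Finite.of_surjective (f.restrictScalars K) hf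

end YangianRep.IsHighestWeight

/-! ### Tensor products of highest weight vectors -/

namespace YangianRep

open Yangian

variable {K : Type u} [Field K] {n : ℕ}

theorem isHighestWeight_counit :
    IsHighestWeight ((Algebra.ofId K (Module.End K K)).comp (counit K n)) 1 1 where
  ne_zero := one_ne_zero
  upper i j r h := by
    have : counit K n (t K n i j r) = 0 := by rw [counit, lift_t]; simp [h.ne]
    simp [this]
  diag i r := by
    have : counit K n (t K n i i r) = if r = 0 then 1 else 0 := by rw [counit, lift_t]; simp
    simp only [AlgHom.comp_apply, this, Pi.one_apply, PowerSeries.coeff_one, Algebra.ofId_apply,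
      Module.algebraMap_end_apply]
  torus := by
    refine ⟨fun _ => 1, fun z i j r x => ?_, fun _ => rfl⟩
    by_cases h : i = j
    · subst h
      simp
    · have : counit K n (t K n i j r) = 0 := by rw [counit, lift_t]; simp [h]
      simp [this]

open TensorProduct

section Tensor

variable {V₁ V₂ : Type u} [AddCommGroup V₁] [Module K V₁] [AddCommGroup V₂] [Module K V₂]

/-- The action of the Yangian on a tensor product. -/
noncomputable def tensorAction (ρ₁ : Yangian K n →ₐ[K] Module.End K V₁)
    (ρ₂ : Yangian K n →ₐ[K] Module.End K V₂) : Yangian K n →ₐ[K] Module.End K (V₁ ⊗[K] V₂) :=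
  (Module.endTensorEndAlgHom (R := K) (S := K) (A := K)).comp
    ((Algebra.TensorProduct.map ρ₁ ρ₂).comp (comul K n))

theorem tensorAction_tmul (ρ₁ : Yangian K n →ₐ[K] Module.End K V₁)
    (ρ₂ : Yangian K n →ₐ[K] Module.End K V₂) (i j : Fin n) (r : ℕ) (x : V₁) (y : V₂) :
    tensorAction ρ₁ ρ₂ (t K n i j r) (x ⊗ₜ[K] y)
      = ∑ m, ∑ a ∈ Finset.HasAntidiagonal.antidiagonal r,
          ρ₁ (t K n i m a.1) x ⊗ₜ[K] ρ₂ (t K n m j a.2) y := by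
  simp only [tensorAction, AlgHom.comp_apply, comul, lift_t, map_sum, Algebra.TensorProduct.map_tmul,
    LinearMap.sum_apply]
  rfl

theorem tmul_ne_zero_of_ne_zero {v₁ : V₁} {v₂ : V₂} (h₁ : v₁ ≠ 0) (h₂ : v₂ ≠ 0) :
    v₁ ⊗ₜ[K] v₂ ≠ 0 := by
  obtain ⟨f, hf⟩ : ∃ f : Module.Dual K V₁, f v₁ ≠ 0 := by
    by_contra! h
    exact h₁ ((Module.forall_dual_apply_eq_zero_iff K v₁).1 h)
  obtain ⟨g, hg⟩ : ∃ g : Module.Dual K V₂, g v₂ ≠ 0 := by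
    by_contra! h
    exact h₂ ((Module.forall_dual_apply_eq_zero_iff K v₂).1 h)
  intro h
  have := congrArg (fun x => TensorProduct.lid K K (TensorProduct.map f g x)) h
  simp [hf, hg] at this

/-- In the coproduct of `t_ij` with `i < j`, each `m` satisfies `i < m` or `m < j`, so one factor
kills its vector. For `i = j` only `m = i` survives, and the series multiply. The torus factors
`z_i/z_m` and `z_m/z_j` telescope. -/
theorem IsHighestWeight.tensor {ρ₁ : Yangian K n →ₐ[K] Module.End K V₁}
    {ρ₂ : Yangian K n →ₐ[K] Module.End K V₂} {v₁ : V₁} {v₂ : V₂}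
    {μ₁ μ₂ : Fin n → PowerSeries K} (h₁ : IsHighestWeight ρ₁ v₁ μ₁)
    (h₂ : IsHighestWeight ρ₂ v₂ μ₂) :
    IsHighestWeight (tensorAction ρ₁ ρ₂) (v₁ ⊗ₜ[K] v₂) (μ₁ * μ₂) where
  ne_zero := tmul_ne_zero_of_ne_zero h₁.ne_zero h₂.ne_zero
  upper i j r h := by
    rw [tensorAction_tmul]
    refine Finset.sum_eq_zero fun m _ => Finset.sum_eq_zero fun a _ => ?_
    rcases lt_or_ge i m with h' | h'
    · rw [h₁.upper _ _ _ h', zero_tmul]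
    · rw [h₂.upper _ _ _ (h'.trans_lt h), tmul_zero]
  diag i r := by
    rw [tensorAction_tmul, Finset.sum_eq_single i]
    · simp only [h₁.diag, h₂.diag, smul_tmul_smul]
      rw [Pi.mul_apply, PowerSeries.coeff_mul, Finset.sum_smul]
    · intro m _ hm
      refine Finset.sum_eq_zero fun a _ => ?_
      rcases lt_or_gt_of_ne hm with h' | h'
      · rw [h₂.upper _ _ _ h', tmul_zero]
      · rw [h₁.upper _ _ _ h', zero_tmul]
    · simp
  torus := by
    obtain ⟨τ₁, hτ₁, hv₁⟩ := h₁.torus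
    obtain ⟨τ₂, hτ₂, hv₂⟩ := h₂.torus
    refine ⟨fun z => TensorProduct.map (τ₁ z) (τ₂ z), fun z i j r x => ?_, fun z => ?_⟩
    · induction x using TensorProduct.induction_on with
      | zero => simp
      | tmul x y =>
        rw [tensorAction_tmul, TensorProduct.map_tmul, tensorAction_tmul]
        simp only [map_sum, TensorProduct.map_tmul, hτ₁, hτ₂, smul_tmul_smul, Finset.smul_sum]
        refine Finset.sum_congr rfl fun m _ => Finset.sum_congr rfl fun a _ => ?_
        rw [← Units.val_mul, div_mul_div_cancel]
      | add x y hx hy => simp only [map_add, hx, hy, smul_add]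
    · rw [TensorProduct.map_tmul, hv₁, hv₂]

end Tensor

end YangianRep

/-! ### The exterior algebra by creation and annihilation operators -/

section Fock

variable {K : Type u} [Field K] {n : ℕ}

/-- The exterior algebra of `K^n` in its basis of subsets of `{1, …, n}`, with the action of `gl_n`
twisted by the multiple `a` of the trace. -/
def Fock (K : Type u) (n : ℕ) (_ : K) : Type u := Finset (Fin n) → K

namespace Fock

variable {a : K}

noncomputable instance : AddCommGroup (Fock K n a) :=
  inferInstanceAs (AddCommGroup (Finset (Fin n) → K))

noncomputable instance : Module K (Fock K n a) := inferInstanceAs (Module K (Finset (Fin n) → K))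

instance : Module.Finite K (Fock K n a) :=
  inferInstanceAs (Module.Finite K (Finset (Fin n) → K))

@[simp] theorem add_apply (f g : Fock K n a) (S : Finset (Fin n)) : (f + g) S = f S + g S := rfl

@[simp] theorem sub_apply (f g : Fock K n a) (S : Finset (Fin n)) : (f - g) S = f S - g S := rfl

@[simp] theorem smul_apply (c : K) (f : Fock K n a) (S : Finset (Fin n)) : (c • f) S = c * f S := rfl

@[simp] theorem neg_apply (f : Fock K n a) (S : Finset (Fin n)) : (-f) S = -f S := rfl

@[simp] theorem zero_apply (S : Finset (Fin n)) : (0 : Fock K n a) S = 0 := rfl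

@[ext] theorem ext {K : Type u} {n : ℕ} {a : K} {f g : Fock K n a} (h : ∀ S, f S = g S) : f = g := funext h

/-- The sign `(-1)^#{s ∈ S, s < i}`. -/
def sign (K : Type u) [Field K] (i : Fin n) (S : Finset (Fin n)) : K :=
  (-1) ^ (S.filter (· < i)).card

theorem sign_mul_self (i : Fin n) (S : Finset (Fin n)) : sign K i S * sign K i S = 1 := by
  rw [sign, ← pow_add, Even.neg_one_pow ⟨_, rfl⟩]

theorem sign_ne_zero (i : Fin n) (S : Finset (Fin n)) : sign K i S ≠ 0 :=
  left_ne_zero_of_mul_eq_one (sign_mul_self i S)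

/-- The sign of the transposition of two fermionic operators. -/
def swapSign (K : Type u) [Field K] (i j : Fin n) : K := if i < j then -1 else 1

theorem swapSign_comm {i j : Fin n} (h : i ≠ j) : swapSign K i j = -swapSign K j i := by
  rcases lt_or_gt_of_ne h with h | h
  · simp [swapSign, h, h.not_gt]
  · simp [swapSign, h, h.not_gt]

theorem sign_insert {i : Fin n} {S : Finset (Fin n)} (h : i ∉ S) (j : Fin n) :
    sign K j (insert i S) = swapSign K i j * sign K j S := by
  rw [sign, sign, swapSign, Finset.filter_insert]
  split_ifs with h'
  · rw [Finset.card_insert_of_notMem (by simp [h]), pow_succ]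
    ring
  · rw [one_mul]

theorem sign_erase {i : Fin n} {S : Finset (Fin n)} (h : i ∈ S) (j : Fin n) :
    sign K j (S.erase i) = swapSign K i j * sign K j S := by
  have h₁ := sign_insert (K := K) (Finset.notMem_erase i S) j
  rw [Finset.insert_erase h] at h₁
  rw [h₁, ← mul_assoc]
  rw [swapSign]
  split_ifs <;> simp

theorem swapSign_self (i : Fin n) : swapSign K i i = 1 := by simp [swapSign]

/-- The creation operator, multiplication by the `i`-th basis vector. -/
def create (a : K) (i : Fin n) : Module.End K (Fock K n a) where
  toFun f := fun S => if i ∈ S then sign K i S * f (S.erase i) else 0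
  map_add' f g := funext fun S => by
    change (if i ∈ S then sign K i S * (f (S.erase i) + g (S.erase i)) else 0) = (if i ∈ S then sign K i S * f (S.erase i) else 0) + (if i ∈ S then sign K i S * g (S.erase i) else 0)
    split_ifs <;> ring
  map_smul' c f := funext fun S => by
    change (if i ∈ S then sign K i S * (c * f (S.erase i)) else 0) = c * (if i ∈ S then sign K i S * f (S.erase i) else 0)
    split_ifs <;> ring

/-- The annihilation operator, contraction with the `i`-th dual basis vector. -/
def annihilate (a : K) (i : Fin n) : Module.End K (Fock K n a) where
  toFun f := fun S => if i ∈ S then 0 else sign K i S * f (insert i S)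
  map_add' f g := funext fun S => by
    change (if i ∈ S then 0 else sign K i S * (f (insert i S) + g (insert i S))) = (if i ∈ S then 0 else sign K i S * f (insert i S)) + (if i ∈ S then 0 else sign K i S * g (insert i S))
    split_ifs <;> ring
  map_smul' c f := funext fun S => by
    change (if i ∈ S then 0 else sign K i S * (c * f (insert i S))) = c * (if i ∈ S then 0 else sign K i S * f (insert i S))
    split_ifs <;> ring

theorem create_apply (i : Fin n) (f : Fock K n a) (S : Finset (Fin n)) :
    create a i f S = if i ∈ S then sign K i S * f (S.erase i) else 0 := rfl

theorem annihilate_apply (i : Fin n) (f : Fock K n a) (S : Finset (Fin n)) :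
    annihilate a i f S = if i ∈ S then 0 else sign K i S * f (insert i S) := rfl

theorem create_mul_create (i j : Fin n) : create a i * create a j = -(create a j * create a i) := by
  ext f S
  simp only [Module.End.mul_apply, LinearMap.neg_apply, neg_apply, create_apply]
  by_cases hij : i = j
  · subst hij; simp
  · by_cases hi : i ∈ S <;> by_cases hj : j ∈ S <;> simp [hi, hj, hij, Ne.symm hij]
    rw [sign_erase hi, sign_erase hj, swapSign_comm hij, Finset.erase_right_comm]
    ring

theorem annihilate_mul_annihilate (i j : Fin n) :
    annihilate a i * annihilate a j = -(annihilate a j * annihilate a i) := by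
  ext f S
  simp only [Module.End.mul_apply, LinearMap.neg_apply, neg_apply, annihilate_apply]
  by_cases hij : i = j
  · subst hij; simp
  · by_cases hi : i ∈ S <;> by_cases hj : j ∈ S <;> simp [hi, hj, hij, Ne.symm hij]
    rw [sign_insert hi, sign_insert hj, swapSign_comm hij, Finset.insert_comm]
    ring

theorem annihilate_mul_create (i j : Fin n) :
    annihilate a i * create a j = (if i = j then 1 else 0) - create a j * annihilate a i := by
  ext f S
  by_cases hij : i = j
  · subst hij
    simp only [Module.End.mul_apply, LinearMap.sub_apply, sub_apply, create_apply,
      annihilate_apply, if_true, Module.End.one_apply]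
    by_cases hi : i ∈ S
    · simp only [hi, if_true, Finset.notMem_erase, if_false, Finset.insert_erase, sign_erase hi,
        swapSign_self, one_mul, ← mul_assoc, sign_mul_self, sub_self]
    · simp only [hi, if_true, if_false, Finset.mem_insert_self, Finset.erase_insert hi,
        sign_insert hi, swapSign_self, one_mul, ← mul_assoc, sign_mul_self, sub_zero]
  · simp only [Module.End.mul_apply, LinearMap.sub_apply, sub_apply, create_apply,
      annihilate_apply, hij, if_false, LinearMap.zero_apply, zero_apply]
    by_cases hi : i ∈ S <;> by_cases hj : j ∈ S <;> simp [hi, hj, hij, Ne.symm hij]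
    rw [sign_insert hi, sign_erase hj, swapSign_comm hij, Finset.erase_insert_of_ne hij]
    ring

/-- The matrix units acting on the exterior algebra. -/
noncomputable def unit (a : K) (i j : Fin n) : Module.End K (Fock K n a) :=
  create a i * annihilate a j

theorem unit_apply (i j : Fin n) (f : Fock K n a) (S : Finset (Fin n)) :
    unit a i j f S = if i ∈ S ∧ j ∉ S.erase i then
      sign K i S * sign K j (S.erase i) * f (insert j (S.erase i)) else 0 := by
  rw [unit, Module.End.mul_apply, create_apply, annihilate_apply]
  by_cases hi : i ∈ S <;> by_cases hj : j ∈ S.erase i <;> simp only [hi, hj] <;> simp [mul_assoc]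

theorem unit_self_apply (i : Fin n) (f : Fock K n a) (S : Finset (Fin n)) :
    unit a i i f S = if i ∈ S then f S else 0 := by
  rw [unit_apply]
  by_cases hi : i ∈ S
  · simp only [hi, Finset.notMem_erase, not_false_eq_true, and_self, if_true,
      Finset.insert_erase, sign_erase hi, swapSign_self, one_mul, sign_mul_self]
  · simp [hi]

/-- In normal order the quartic term is unchanged when the two units are exchanged, since the signs
from the creators and from the annihilators cancel; only the contractions remain. -/
theorem unit_commutator (i j k l : Fin n) :
    unit a i j * unit a k l - unit a k l * unit a i j
      = (if j = k then unit a i l else 0) - if l = i then unit a k j else 0 := by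
  have h : ∀ i j k l : Fin n, unit a i j * unit a k l
      = (if j = k then unit a i l else 0)
        - create a i * create a k * (annihilate a j * annihilate a l) := by
    intro i j k l
    rw [unit, unit, mul_assoc, ← mul_assoc (annihilate a j), annihilate_mul_create]
    split_ifs <;> simp [unit, sub_mul, mul_sub, mul_assoc]
  rw [h, h, create_mul_create i k, annihilate_mul_annihilate j l]
  simp only [neg_mul, mul_neg, neg_neg]
  abel

/-- The action of `gl_n` on the exterior algebra, twisted by `a` times the trace. -/
noncomputable def actionLinear (n : ℕ) (a : K) :
    Matrix (Fin n) (Fin n) K →ₗ[K] Module.End K (Fock K n a) where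
  toFun A := ∑ i, ∑ j, A i j • unit a i j + (a * A.trace) • 1
  map_add' A B := by
    simp only [Matrix.add_apply, add_smul, Finset.sum_add_distrib, Matrix.trace_add, mul_add]
    abel
  map_smul' c A := by
    simp only [Matrix.smul_apply, smul_eq_mul, mul_smul, Finset.smul_sum, Matrix.trace_smul,
      RingHom.id_apply, smul_add]
    rw [smul_comm a c]

theorem actionLinear_single (i j : Fin n) (c : K) :
    actionLinear n a (Matrix.single i j c) = c • unit a i j + (if i = j then a * c else 0) • 1 := by
  change ∑ k, ∑ l, Matrix.single i j c k l • unit a k l + (a * (Matrix.single i j c).trace) • 1 = _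
  rw [Finset.sum_eq_single i, Finset.sum_eq_single j]
  · by_cases h : i = j
    · subst h; simp
    · simp [h, Matrix.trace_single_eq_of_ne]
  · intro l _ hl
    simp [Ne.symm hl]
  · simp
  · intro k _ hk
    exact Finset.sum_eq_zero fun l _ => by simp [Ne.symm hk]
  · simp

theorem actionLinear_lie (A B : Matrix (Fin n) (Fin n) K) :
    actionLinear n a ⁅A, B⁆ = ⁅actionLinear n a A, actionLinear n a B⁆ := by
  induction A using Matrix.induction_on' with
  | h_zero => simp
  | h_add A A' h h' => simp only [add_lie, map_add, h, h']
  | h_std_basis i j c =>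
    induction B using Matrix.induction_on' with
    | h_zero => simp
    | h_add A A' h h' => simp only [lie_add, map_add, h, h']
    | h_std_basis k l d =>
      have h : ⁅actionLinear n a (Matrix.single i j c), actionLinear n a (Matrix.single k l d)⁆
          = (c * d) • (unit a i j * unit a k l - unit a k l * unit a i j) := by
        rw [actionLinear_single, actionLinear_single, LieRing.of_associative_ring_bracket]
        simp only [add_mul, mul_add, smul_mul_assoc, mul_smul_comm, mul_one, one_mul]
        module
      rw [h, unit_commutator, LieRing.of_associative_ring_bracket, map_sub]
      by_cases h₁ : j = k <;> by_cases h₂ : l = i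
      · subst h₁ h₂
        simp [actionLinear_single, mul_comm d c, smul_sub]
      · subst h₁
        simp [h₂, Ne.symm h₂, actionLinear_single]
      · subst h₂
        simp [h₁, Ne.symm h₁, actionLinear_single, mul_comm d c]
      · simp [h₁, h₂]

/-- The action of `gl_n` on the exterior algebra, as a homomorphism of Lie algebras. -/
noncomputable def action (n : ℕ) (a : K) :
    Matrix (Fin n) (Fin n) K →ₗ⁅K⁆ Module.End K (Fock K n a) :=
  { actionLinear n a with map_lie' := fun {A B} => actionLinear_lie A B }

/-- The twist `a` is part of the type, so that different twists carry different Lie module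
structures. -/
noncomputable instance : LieRingModule (Matrix (Fin n) (Fin n) K) (Fock K n a) :=
  LieRingModule.compLieHom (Fock K n a) (action n a)

noncomputable instance : LieModule K (Matrix (Fin n) (Fin n) K) (Fock K n a) :=
  LieModule.compLieHom (Fock K n a) (action n a)

theorem single_lie (i j : Fin n) (f : Fock K n a) :
    ⁅Matrix.single i j (1 : K), f⁆ = unit a i j f + (if i = j then a else 0) • f := by
  change actionLinear n a (Matrix.single i j 1) f = _
  rw [actionLinear_single]
  split_ifs <;> simp

theorem lie_eq_sum (A : Matrix (Fin n) (Fin n) K) (f : Fock K n a) :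
    ⁅A, f⁆ = ∑ i, ∑ j, A i j • unit a i j f + (a * A.trace) • f := by
  change (∑ i, ∑ j, A i j • unit a i j + (a * A.trace) • 1 : Module.End K (Fock K n a)) f = _
  simp [LinearMap.sum_apply]

end Fock

end Fock

/-! ### Irreducibility of the exterior powers -/

namespace Fock

variable {K : Type u} [Field K] {n : ℕ} {a : K}

/-- The `k`-th exterior power of `K^n`, twisted by `a` times the trace. -/
noncomputable def level (n : ℕ) (a : K) (k : ℕ) :
    LieSubmodule K (Matrix (Fin n) (Fin n) K) (Fock K n a) where
  carrier := {f | ∀ S, S.card ≠ k → f S = 0}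
  add_mem' {f g} hf hg S hS := by rw [add_apply, hf S hS, hg S hS, add_zero]
  zero_mem' _ _ := rfl
  smul_mem' c f hf S hS := by rw [smul_apply, hf S hS, mul_zero]
  lie_mem {A f} hf := by
    let L : Submodule K (Fock K n a) :=
      { carrier := {f | ∀ S, S.card ≠ k → f S = 0}
        add_mem' := fun {f g} hf hg S hS => by rw [add_apply, hf S hS, hg S hS, add_zero]
        zero_mem' := fun _ _ => rfl
        smul_mem' := fun c f hf S hS => by rw [smul_apply, hf S hS, mul_zero] }
    change ⁅A, f⁆ ∈ L
    rw [lie_eq_sum]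
    refine add_mem (sum_mem fun i _ => sum_mem fun j _ => L.smul_mem _ ?_) (L.smul_mem _ hf)
    intro S hS
    rw [unit_apply]
    split_ifs with h
    · rw [hf, mul_zero]
      rwa [Finset.card_insert_of_notMem h.2, Finset.card_erase_add_one h.1]
    · rfl

variable {k : ℕ}

theorem apply_eq_zero (f : level n a k) {S : Finset (Fin n)} (h : S.card ≠ k) : f.1 S = 0 := f.2 S h

/-- The basis vector attached to a subset. -/
noncomputable def delta (a : K) {k : ℕ} (S : Finset (Fin n)) (h : S.card = k) : level n a k :=
  ⟨fun T => if T = S then 1 else 0, fun T hT => if_neg fun hTS : T = S => hT (hTS ▸ h)⟩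

theorem delta_apply (S : Finset (Fin n)) (h : S.card = k) (T : Finset (Fin n)) :
    (delta a S h).1 T = if T = S then 1 else 0 := rfl

theorem coe_single_lie (i j : Fin n) (f : level n a k) :
    (⁅Matrix.single i j (1 : K), f⁆ : level n a k).1
      = unit a i j f.1 + (if i = j then a else 0) • f.1 := by
  rw [LieSubmodule.coe_bracket, single_lie]

/-- `E_ii - a` is the projection onto the subsets containing `i`. These projections and their
complements cut out any single subset, in every characteristic. -/
theorem exists_restrict_mem (N : LieSubmodule K (Matrix (Fin n) (Fin n) K) (level n a k))
    {f : level n a k} (hf : f ∈ N) (S₀ : Finset (Fin n)) (I : Finset (Fin n)) :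
    ∃ g ∈ N, ∀ S, g.1 S = if ∀ i ∈ I, (i ∈ S ↔ i ∈ S₀) then f.1 S else 0 := by
  induction I using Finset.induction_on with
  | empty => exact ⟨f, hf, fun S => by simp⟩
  | insert i I _ ih =>
    obtain ⟨g, hg, h⟩ := ih
    have h₁ : ⁅Matrix.single i i (1 : K), g⁆ - a • g ∈ N :=
      sub_mem (LieSubmodule.lie_mem _ hg) (N.smul_mem _ hg)
    have h₂ : ∀ S, (⁅Matrix.single i i (1 : K), g⁆ - a • g).1 S = if i ∈ S then g.1 S else 0 := by
      intro S
      change (⁅Matrix.single i i (1 : K), g⁆ : level n a k).1 S - a * g.1 S = _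
      rw [coe_single_lie]
      simp [unit_self_apply]
    by_cases hi : i ∈ S₀
    · refine ⟨_, h₁, fun S => ?_⟩
      rw [h₂, h]
      by_cases hS : i ∈ S <;> simp [hi, hS]
    · refine ⟨_, sub_mem hg h₁, fun S => ?_⟩
      change g.1 S - (⁅Matrix.single i i (1 : K), g⁆ - a • g).1 S = _
      rw [h₂, h]
      by_cases hS : i ∈ S <;> simp [hi, hS]

theorem delta_mem_of_ne_zero (N : LieSubmodule K (Matrix (Fin n) (Fin n) K) (level n a k))
    {f : level n a k} (hf : f ∈ N) {S : Finset (Fin n)} (h : S.card = k) (h₀ : f.1 S ≠ 0) :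
    delta a S h ∈ N := by
  obtain ⟨g, hg, h₁⟩ := exists_restrict_mem N hf S Finset.univ
  have : delta a S h = (f.1 S)⁻¹ • g := by
    refine Subtype.ext (Fock.ext fun T => ?_)
    change (delta a S h).1 T = (f.1 S)⁻¹ * g.1 T
    rw [h₁, delta_apply]
    by_cases hT : T = S
    · subst hT
      simp [h₀]
    · rw [if_neg hT, if_neg, mul_zero]
      exact fun h => hT (Finset.ext fun i => h i (Finset.mem_univ i))
  rw [this]
  exact N.smul_mem _ hg

/-- `E_ij` replaces an element `j` of `S \ T` by an element `i` of `T \ S`, with coefficient a sign,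
and so brings `S` closer to `T`. -/
theorem delta_mem (N : LieSubmodule K (Matrix (Fin n) (Fin n) K) (level n a k))
    {S T : Finset (Fin n)} (hS : S.card = k) (hT : T.card = k) (h : delta a S hS ∈ N) :
    delta a T hT ∈ N := by
  induction hm : (T \ S).card generalizing S with
  | zero =>
    have h₁ : T ⊆ S := Finset.sdiff_eq_empty_iff_subset.1 (Finset.card_eq_zero.1 hm)
    have h₂ := Finset.eq_of_subset_of_card_le h₁ (by omega)
    subst h₂
    exact h
  | succ m ih =>
    obtain ⟨i, hi⟩ : (T \ S).Nonempty := Finset.card_pos.1 (by omega)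
    obtain ⟨j, hj⟩ : (S \ T).Nonempty := Finset.card_pos.1 (by
      rw [Finset.card_sdiff_comm (hS.trans hT.symm)]; omega)
    rw [Finset.mem_sdiff] at hi hj
    have hij : i ≠ j := fun h => hi.2 (h ▸ hj.1)
    have hi' : i ∉ S.erase j := fun h => hi.2 (Finset.mem_of_mem_erase h)
    have hcard : (insert i (S.erase j)).card = k := by
      rw [Finset.card_insert_of_notMem hi', Finset.card_erase_add_one hj.1, hS]
    refine ih hcard ?_ ?_
    · refine delta_mem_of_ne_zero N (LieSubmodule.lie_mem (x := Matrix.single i j 1) _ h) hcard ?_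
      rw [coe_single_lie]
      simp only [add_apply, hij, if_false, smul_apply, zero_mul, add_zero]
      rw [unit_apply, Finset.erase_insert hi', if_pos ⟨Finset.mem_insert_self _ _,
        Finset.notMem_erase _ _⟩, Finset.insert_erase hj.1, delta_apply, if_pos rfl, mul_one]
      exact mul_ne_zero (sign_ne_zero _ _) (sign_ne_zero _ _)
    · have : T \ insert i (S.erase j) = (T \ S).erase i := by
        ext x
        simp only [Finset.mem_sdiff, Finset.mem_insert, Finset.mem_erase]
        by_cases hx : x = j
        · subst hx; simp [hj.2]
        · tauto
      rw [this, Finset.card_erase_of_mem (Finset.mem_sdiff.2 hi), hm]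
      rfl

theorem eq_sum_delta (f : level n a k) :
    f = ∑ S : {S : Finset (Fin n) // S.card = k}, f.1 S.1 • delta a S.1 S.2 := by
  refine Subtype.ext (Fock.ext fun T => ?_)
  have h : ∀ s : Finset {S : Finset (Fin n) // S.card = k},
      (∑ S ∈ s, f.1 S.1 • delta a S.1 S.2).1 T = ∑ S ∈ s, f.1 S.1 * if T = S.1 then 1 else 0 := by
    intro s
    induction s using Finset.induction_on with
    | empty => rfl
    | insert S s hS ih =>
      rw [Finset.sum_insert hS, Finset.sum_insert hS, ← ih]
      rfl
  rw [h]
  by_cases hT : T.card = k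
  · rw [Finset.sum_eq_single ⟨T, hT⟩]
    · simp
    · intro S _ hS
      rw [if_neg fun h => hS (Subtype.ext h.symm), mul_zero]
    · simp
  · rw [apply_eq_zero f hT, Finset.sum_eq_zero]
    intro S _
    rw [if_neg fun h : T = S.1 => hT (h ▸ S.2), mul_zero]

theorem level_isIrreducible (a : K) (hk : k ≤ n) :
    LieModule.IsIrreducible K (Matrix (Fin n) (Fin n) K) (level n a k) := by
  obtain ⟨S, -, hS⟩ := Finset.exists_subset_card_eq (s := (Finset.univ : Finset (Fin n))) (n := k)
    (by simpa using hk)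
  have : Nontrivial (level n a k) := by
    refine ⟨delta a S hS, 0, fun h => ?_⟩
    have := congrArg (fun f : level n a k => f.1 S) h
    simp [delta_apply] at this
  refine LieModule.IsIrreducible.mk fun N hN => ?_
  obtain ⟨f, hf, h₀⟩ : ∃ f ∈ N, f ≠ 0 := by
    by_contra! h
    exact hN ((LieSubmodule.eq_bot_iff N).2 h)
  obtain ⟨S, hS⟩ : ∃ S, f.1 S ≠ 0 := by
    by_contra! h
    exact h₀ (Subtype.ext (Fock.ext h))
  have hc : S.card = k := by
    by_contra h
    exact hS (apply_eq_zero f h)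
  have h₁ := delta_mem_of_ne_zero N hf hc hS
  refine eq_top_iff.2 fun g _ => ?_
  rw [eq_sum_delta g]
  exact sum_mem fun T _ => N.smul_mem _ (delta_mem N hc T.2 h₁)

/-- The action of the Yangian on the exterior power. -/
noncomputable def yangianAction (n : ℕ) (a : K) (k : ℕ) :
    Yangian K n →ₐ[K] Module.End K (level n a k) :=
  (UniversalEnvelopingAlgebra.lift K
    (LieModule.toEnd K (Matrix (Fin n) (Fin n) K) (level n a k))).comp (Yangian.ev K n)

end Fock

section ExteriorRep

variable {K : Type u} [Field K]

/-- The evaluation module given by the `k`-th exterior power, twisted by `a` times the trace. -/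
noncomputable def exteriorRep (n : ℕ) (a : K) (k : ℕ) : YangianRep K n where
  V := Fock.level n a k
  ρ := Fock.yangianAction n a k

theorem exteriorRep_finite (n : ℕ) (a : K) (k : ℕ) : Module.Finite K (exteriorRep n a k).V :=
  inferInstanceAs (Module.Finite K (Fock.level n a k).toSubmodule)

theorem exteriorRep_isEvaluationModule {n : ℕ} (a : K) {k : ℕ} (hk : k ≤ n) :
    (exteriorRep n a k).IsEvaluationModule :=
  ⟨(inferInstance : LieRingModule (Matrix (Fin n) (Fin n) K) (Fock.level n a k)),
    (inferInstance : LieModule K (Matrix (Fin n) (Fin n) K) (Fock.level n a k)),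
    exteriorRep_finite n a k, Fock.level_isIrreducible a hk, rfl⟩

end ExteriorRep

/-! ### Highest weights of the exterior powers -/

namespace Fock

open Yangian

variable {K : Type u} [Field K] {n : ℕ} {a : K} {k : ℕ}

theorem yangianAction_zero (i j : Fin n) :
    yangianAction n a k (t K n i j 0) = if i = j then 1 else 0 := by
  rw [t_zero]
  split_ifs <;> simp

theorem yangianAction_one (i j : Fin n) (f : level n a k) :
    yangianAction n a k (t K n i j 1) f = ⁅Matrix.single i j (1 : K), f⁆ := by
  rw [yangianAction, AlgHom.comp_apply, ev, lift_t, evFun, UniversalEnvelopingAlgebra.lift_ι_apply]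
  rfl

theorem yangianAction_add_two (i j : Fin n) (r : ℕ) :
    yangianAction n a k (t K n i j (r + 2)) = 0 := by
  rw [yangianAction, AlgHom.comp_apply, ev, lift_t, evFun, map_zero]

/-- The torus of `GL_n` acting on the exterior power. -/
noncomputable def torus (a : K) (k : ℕ) (S₀ : Finset (Fin n)) (z : Fin n → Kˣ) :
    Module.End K (level n a k) where
  toFun f := ⟨fun S => (∏ i ∈ S, (z i : K)) * (∏ i ∈ S₀, (z i : K))⁻¹ * f.1 S, fun _ hS =>
    mul_eq_zero_of_right _ (apply_eq_zero f hS)⟩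
  map_add' f g := Subtype.ext (Fock.ext fun S => mul_add _ (f.1 S) (g.1 S))
  map_smul' c f := Subtype.ext (Fock.ext fun S => mul_left_comm _ c (f.1 S))

theorem torus_apply (S₀ : Finset (Fin n)) (z : Fin n → Kˣ) (f : level n a k) (S : Finset (Fin n)) :
    (torus a k S₀ z f).1 S = (∏ i ∈ S, (z i : K)) * (∏ i ∈ S₀, (z i : K))⁻¹ * f.1 S := rfl

/-- Replacing `j` by `i` changes the monomial of a subset by `z_i/z_j`. The normalisation by `S₀`,
which fixes its basis vector, is a constant, and the trace twist enters only for `i = j`, where the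
ratio is `1`. -/
theorem torus_single_lie (S₀ : Finset (Fin n)) (z : Fin n → Kˣ) (i j : Fin n) (f : level n a k) :
    torus a k S₀ z ⁅Matrix.single i j (1 : K), f⁆
      = ((z i / z j : Kˣ) : K) • ⁅Matrix.single i j (1 : K), torus a k S₀ z f⁆ := by
  refine Subtype.ext (Fock.ext fun S => ?_)
  change _ = ((z i / z j : Kˣ) : K) * (⁅Matrix.single i j (1 : K), torus a k S₀ z f⁆ : level n a k).1 S
  rw [torus_apply, coe_single_lie, coe_single_lie, add_apply, add_apply, smul_apply, smul_apply,
    torus_apply, unit_apply, unit_apply, torus_apply]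
  have h₁ : (if i = j then a else 0) * ((z i / z j : Kˣ) : K) = if i = j then a else 0 := by
    split_ifs with h
    · subst h; simp
    · simp
  have h₂ : ((z i / z j : Kˣ) : K) * z j = z i := by
    rw [← Units.val_mul, div_mul_cancel]
  rw [mul_add, mul_add]
  congr 1
  · split_ifs with h
    · obtain ⟨hi, hj⟩ := h
      rw [Finset.prod_insert hj, ← Finset.mul_prod_erase S _ hi, ← h₂]
      ring
    · simp
  · linear_combination (-(∏ i ∈ S, (z i : K)) * (∏ i ∈ S₀, (z i : K))⁻¹ * f.1 S) * h₁

/-- The index set of the highest weight vector. -/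
def top (n k : ℕ) : Finset (Fin n) := Finset.univ.filter fun i => (i : ℕ) < k

theorem card_top (h : k ≤ n) : (top n k).card = k := by
  rw [top, Fin.card_filter_val_lt, min_eq_right h]

theorem single_lie_delta_of_lt (hk : k ≤ n) {i j : Fin n} (h : i < j) :
    ⁅Matrix.single i j (1 : K), delta a (top n k) (card_top hk)⁆ = 0 := by
  refine Subtype.ext (Fock.ext fun S => ?_)
  rw [coe_single_lie, if_neg h.ne, zero_smul, add_zero, unit_apply]
  split_ifs with h'
  · rw [delta_apply, if_neg, mul_zero]
    · rfl
    · intro h₁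
      have hj : j ∈ top n k := h₁ ▸ Finset.mem_insert_self _ _
      have hi : i ∉ top n k := by
        rw [← h₁, Finset.mem_insert, not_or]
        exact ⟨h.ne, Finset.notMem_erase _ _⟩
      simp only [top, Finset.mem_filter, Finset.mem_univ, true_and] at hi hj
      exact hi (lt_trans h hj)
  · rfl

theorem single_lie_delta_self (hk : k ≤ n) (i : Fin n) :
    ⁅Matrix.single i i (1 : K), delta a (top n k) (card_top hk)⁆
      = ((if (i : ℕ) < k then 1 else 0) + a) • delta a (top n k) (card_top hk) := by
  refine Subtype.ext (Fock.ext fun S => ?_)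
  change _ = ((if (i : ℕ) < k then 1 else 0) + a) * (delta a (top n k) (card_top hk)).1 S
  rw [coe_single_lie, if_pos rfl, add_apply, unit_self_apply, smul_apply, delta_apply]
  by_cases hS : S = top n k
  · subst hS
    simp [top]
  · simp [hS]

/-- The highest weight of the `k`-th exterior power twisted by `a` times the trace. -/
noncomputable def weight (n : ℕ) (a : K) (k : ℕ) (i : Fin n) : PowerSeries K :=
  1 + PowerSeries.C ((if (i : ℕ) < k then 1 else 0) + a) * PowerSeries.X

theorem isHighestWeight (a : K) (hk : k ≤ n) :
    YangianRep.IsHighestWeight (yangianAction n a k) (delta a (top n k) (card_top hk))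
      (weight n a k) where
  ne_zero h := by
    have := congrArg (fun f : level n a k => f.1 (top n k)) h
    simp [delta_apply] at this
  upper i j r h := by
    match r with
    | 0 => rw [yangianAction_zero, if_neg h.ne]; rfl
    | 1 => rw [yangianAction_one, single_lie_delta_of_lt hk h]
    | r + 2 => rw [yangianAction_add_two]; rfl
  diag i r := by
    match r with
    | 0 => rw [yangianAction_zero, if_pos rfl]; simp [weight]
    | 1 =>
      rw [yangianAction_one, single_lie_delta_self hk]
      simp [weight, PowerSeries.coeff_one]
    | r + 2 =>
      rw [yangianAction_add_two]
      rw [weight, map_add, PowerSeries.coeff_one, PowerSeries.coeff_C_mul, PowerSeries.coeff_X]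
      simp
  torus := by
    refine ⟨torus a k (top n k), fun z i j r f => ?_, fun z => ?_⟩
    · match r with
      | 0 =>
        rw [yangianAction_zero]
        split_ifs with h
        · subst h; simp
        · simp
      | 1 => rw [yangianAction_one, yangianAction_one, torus_single_lie]
      | r + 2 => rw [yangianAction_add_two]; simp
    · refine Subtype.ext (Fock.ext fun S => ?_)
      rw [torus_apply, delta_apply]
      split_ifs with h
      · subst h
        rw [mul_inv_cancel₀, mul_one]
        exact Finset.prod_ne_zero_iff.2 fun i _ => (z i).ne_zero
      · rw [mul_zero]

end Fock

/-! ### Tensor products of exterior powers -/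

section Tensor

variable {K : Type u} [Field K] {n : ℕ}

open YangianRep

theorem tensorList_finite (l : List (K × ℕ)) :
    Module.Finite K (tensorList (l.map fun x => exteriorRep n x.1 x.2)).V := by
  induction l with
  | nil => exact inferInstanceAs (Module.Finite K K)
  | cons x l ih =>
    have := exteriorRep_finite n x.1 x.2
    exact Module.Finite.tensorProduct K (exteriorRep n x.1 x.2).V
      (tensorList (l.map fun x => exteriorRep n x.1 x.2)).V

theorem exists_isHighestWeight_tensorList (l : List (K × ℕ)) (hl : ∀ x ∈ l, x.2 ≤ n) :
    ∃ v, IsHighestWeight (tensorList (l.map fun x => exteriorRep n x.1 x.2)).ρ v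
      (l.map fun x => Fock.weight n x.1 x.2).prod := by
  induction l with
  | nil => exact ⟨(1 : K), isHighestWeight_counit⟩
  | cons x l ih =>
    obtain ⟨v, hv⟩ := ih fun y hy => hl y (List.mem_cons_of_mem x hy)
    rw [List.map_cons, List.map_cons, List.prod_cons]
    exact ⟨_, (Fock.isHighestWeight x.1 (hl x List.mem_cons_self)).tensor hv⟩

end Tensor

/-! ### Weight series and the roots of the polynomials -/

section Series

variable {K : Type u} [Field K] {n : ℕ}

theorem evalShift_eq_prod [IsAlgClosed K] {P : Polynomial K} (hP : P.Monic) (c : K) :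
    evalShift P c
      = (P.roots.map fun b => HahnSeries.single (-1 : ℤ) (1 : K) + HahnSeries.C (c - b)).prod := by
  have h : P = (P.roots.map fun b => Polynomial.X - Polynomial.C b).prod :=
    (IsAlgClosed.splits P).eq_prod_roots_of_monic hP
  conv_lhs => rw [h]
  rw [evalShift, Polynomial.eval₂_multiset_prod, Multiset.map_map]
  congr 1
  refine Multiset.map_congr rfl fun b _ => ?_
  simp [add_sub_assoc]

/-- The variable is `u⁻¹`, so `single (-1) 1` is `u`; clearing the denominator makes the weight
linear in `u`. -/
theorem single_mul_coe_weight (a : K) (k : ℕ) (i : Fin n) :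
    HahnSeries.single (-1 : ℤ) (1 : K) * (Fock.weight n a k i : LaurentSeries K)
      = HahnSeries.single (-1 : ℤ) (1 : K) + HahnSeries.C ((if (i : ℕ) < k then 1 else 0) + a) := by
  rw [Fock.weight, map_add, map_one (HahnSeries.ofPowerSeries ℤ K), map_mul, HahnSeries.ofPowerSeries_C,
    HahnSeries.ofPowerSeries_X, mul_add, mul_one, mul_left_comm, HahnSeries.single_mul_single]
  simp

theorem constantCoeff_weight (a : K) (k : ℕ) (i : Fin n) :
    PowerSeries.constantCoeff (Fock.weight n a k i) = 1 := by
  simp [Fock.weight]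

theorem coe_weight_ne_zero (a : K) (k : ℕ) (i : Fin n) :
    (Fock.weight n a k i : LaurentSeries K) ≠ 0 := by
  rw [Ne, map_eq_zero_iff _ HahnSeries.ofPowerSeries_injective]
  intro h
  have := constantCoeff_weight a k i
  simp [h] at this

/-- Indices start at `0`, so the weights of the power `j + 1` drop exactly between the places `j`
and `j + 1`. -/
theorem coe_weight_div_coe_weight (b : K) (i j : Fin n) :
    (Fock.weight (n + 1) (-b) (j + 1) i.castSucc : LaurentSeries K)
        / (Fock.weight (n + 1) (-b) (j + 1) i.succ : LaurentSeries K)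
      = if j = i then (HahnSeries.single (-1 : ℤ) (1 : K) + HahnSeries.C (1 - b))
        / (HahnSeries.single (-1 : ℤ) (1 : K) + HahnSeries.C (0 - b)) else 1 := by
  have hu : HahnSeries.single (-1 : ℤ) (1 : K) ≠ 0 := by simp
  split_ifs with h
  · subst h
    rw [← mul_div_mul_left _ _ hu, single_mul_coe_weight, single_mul_coe_weight]
    simp [sub_eq_add_neg]
  · have h' : (j : ℕ) ≠ i := fun h' => h (Fin.ext h')
    have : Fock.weight (n + 1) (-b) (j + 1) i.castSucc = Fock.weight (n + 1) (-b) (j + 1) i.succ := by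
      have h₁ : (i : ℕ) < j + 1 ↔ (i : ℕ) + 1 < j + 1 := by omega
      simp only [Fock.weight, Fin.val_castSucc, Fin.val_succ, h₁]
    rw [this, div_self (coe_weight_ne_zero _ _ _)]

/-- The parameters of the exterior powers attached to the roots of the polynomials `P_i`. -/
noncomputable def rootParameters (P : Fin n → Polynomial K) : Multiset (K × ℕ) :=
  ∑ j, (P j).roots.map fun b => (-b, (j : ℕ) + 1)

theorem le_of_mem_rootParameters {P : Fin n → Polynomial K} {x : K × ℕ}
    (hx : x ∈ rootParameters P) : x.2 ≤ n + 1 := by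
  obtain ⟨j, -, h⟩ := Multiset.mem_sum.1 hx
  obtain ⟨b, -, rfl⟩ := Multiset.mem_map.1 h
  have := j.2
  dsimp only
  omega

theorem coe_prod_weight (P : Fin n → Polynomial K) (i : Fin (n + 1)) :
    (((rootParameters P).toList.map fun x => Fock.weight (n + 1) x.1 x.2).prod i : LaurentSeries K)
      = ∏ j : Fin n, ((P j).roots.map fun b =>
          (Fock.weight (n + 1) (-b) (j + 1) i : LaurentSeries K)).prod := by
  have h : ((rootParameters P).toList.map fun x => Fock.weight (n + 1) x.1 x.2).prod i
      = ((rootParameters P).map fun x => Fock.weight (n + 1) x.1 x.2 i).prod := by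
    conv_rhs => rw [← Multiset.coe_toList (rootParameters P)]
    rw [Multiset.map_coe, Multiset.prod_coe]
    exact (map_list_prod (Pi.evalMonoidHom (fun _ => PowerSeries K) i) _).trans (by rw [List.map_map]; rfl)
  rw [h, rootParameters, ← Multiset.coe_mapAddMonoidHom, map_sum, Multiset.prod_sum, map_prod]
  refine Finset.prod_congr rfl fun j _ => ?_
  rw [Multiset.coe_mapAddMonoidHom, Multiset.map_map, map_multiset_prod, Multiset.map_map]
  rfl

/-- Only the roots of `P i` contribute at place `i`, each by `(u + 1 - b)/(u - b)`. -/
theorem coe_prod_weight_div [IsAlgClosed K] {P : Fin n → Polynomial K} (hP : ∀ i, (P i).Monic)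
    (i : Fin n) :
    (((rootParameters P).toList.map fun x => Fock.weight (n + 1) x.1 x.2).prod i.castSucc :
        LaurentSeries K)
      / (((rootParameters P).toList.map fun x => Fock.weight (n + 1) x.1 x.2).prod i.succ :
        LaurentSeries K) = evalShift (P i) 1 / evalShift (P i) 0 := by
  rw [coe_prod_weight, coe_prod_weight, ← Finset.prod_div_distrib]
  simp only [← Multiset.prod_map_div, coe_weight_div_coe_weight]
  rw [Finset.prod_eq_single i]
  · rw [evalShift_eq_prod (hP i), evalShift_eq_prod (hP i), ← Multiset.prod_map_div]
    simp
  · intro j _ hj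
    simp [hj]
  · simp

theorem constantCoeff_prod_weight (l : List (K × ℕ)) (i : Fin n) :
    PowerSeries.constantCoeff ((l.map fun x => Fock.weight n x.1 x.2).prod i) = 1 := by
  induction l with
  | nil => simp
  | cons x l ih => rw [List.map_cons, List.prod_cons, Pi.mul_apply, map_mul, ih,
      constantCoeff_weight, mul_one]

end Series

theorem theorem3p2p6 (p : ℕ) [Fact p.Prime] (hp : 2 < p) (n : ℕ)
    (P : Fin n → Polynomial (AlgebraicClosure (ZMod p))) (hP : ∀ i, (P i).Monic) :
    ∃ μ : Fin (n + 1) → PowerSeries (AlgebraicClosure (ZMod p)),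
      (∀ i, PowerSeries.constantCoeff (μ i) = 1) ∧
      (∀ i : Fin n,
        (μ i.castSucc : LaurentSeries (AlgebraicClosure (ZMod p))) / μ i.succ
          = evalShift (P i) 1 / evalShift (P i) 0) ∧
      Module.Finite (AlgebraicClosure (ZMod p)) (Yangian.IrredHW μ) ∧
      IsSimpleModule (Yangian (AlgebraicClosure (ZMod p)) (n + 1)) (Yangian.IrredHW μ) ∧
      ∃ l : List (YangianRep (AlgebraicClosure (ZMod p)) (n + 1)),
        (∀ W ∈ l, W.IsEvaluationModule) ∧
        Yangian.IsSubquotient (Yangian.IrredHW μ) (YangianRep.tensorList l) := by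
  have hle : ∀ x ∈ (rootParameters P).toList, x.2 ≤ n + 1 := fun x hx =>
    le_of_mem_rootParameters (Multiset.mem_toList.1 hx)
  obtain ⟨v, hv⟩ := exists_isHighestWeight_tensorList (rootParameters P).toList hle
  have := tensorList_finite (n := n + 1) (rootParameters P).toList
  have : Infinite (AlgebraicClosure (ZMod p)) := IsAlgClosed.instInfinite
  refine ⟨_, constantCoeff_prod_weight _, coe_prod_weight_div hP, hv.finite, hv.isSimpleModule, _,
    ?_, hv.isSubquotient⟩
  intro W hW
  obtain ⟨x, hx, rfl⟩ := List.mem_map.1 hW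
  exact exteriorRep_isEvaluationModule _ (hle x hx)
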